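/- For a finite graph $H$, let $\tau(H)$ be the minimum size of a set $F$ of edges of $H$ such that every triangle of $H$ contains an edge of $F$. For $p=p(n)\in[0,1]$, let $G_{n,p}$ be the binomial random graph on $n$ vertices (each of the $\binom n2$ possible edges is present independently with probability $p$), and set $m=\binom n2 p$, $d=d(n)=(n-2)p^2$ and $$\psi(d)=\tfrac12\left[1-\exp\left(-\tfrac d2\,(1+e^{-d})\right)\right].$$ **Theorem.** If $d=\Theta(1)$ as $n\to\infty$ (that is, $d(n)$ is bounded above and below by positive constants for all large $n$), then with high probability $$\tau(G_{n,p})<(1+o(1))\,\psi(d)\,m;$$ that is, there is a sequence $\varepsilon_n\to0$ such that $\Pr\big(\tau(G_{n,p})<(1+\varepsilon_n)\,\psi(d(n))\,m\big)\to1$ as $n\to\infty$. -/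

import Mathlib

open Filter Topology Asymptotics
open scoped unitInterval

namespace TriangleCover

/-- `F` is a cover of `G`: a set of edges of `G` such that every triangle (3-clique) of `G`
has at least one of its edges in `F`. -/
def IsCover {V : Type*} (G : SimpleGraph V) (F : Finset (Sym2 V)) : Prop :=
  (F : Set (Sym2 V)) ⊆ G.edgeSet ∧ ∀ T : Finset V, G.IsNClique 3 T → ∃ e ∈ F, e ∈ T.sym2

/-- The cover number `τ(G)` of a finite graph: the minimum size of a cover. -/
noncomputable def tau {V : Type*} [Finite V] (G : SimpleGraph V) : ℕ :=
  sInf {k : ℕ | ∃ F : Finset (Sym2 V), IsCover G F ∧ F.card = k}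

/-- Covers exist (the set of all edges is one), so the minimum defining `tau` is attained. -/
theorem exists_isCover_card_eq_tau {V : Type*} [Finite V] (G : SimpleGraph V) :
    ∃ F : Finset (Sym2 V), IsCover G F ∧ F.card = tau G := by
  classical
  have hfin : G.edgeSet.Finite := Set.toFinite _
  refine Nat.sInf_mem (s := {k : ℕ | ∃ F : Finset (Sym2 V), IsCover G F ∧ F.card = k})
    ⟨_, hfin.toFinset, ⟨by simp, fun T hT => ?_⟩, rfl⟩
  obtain ⟨a, b, c, hab, -, -, rfl⟩ := SimpleGraph.is3Clique_iff.1 hT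
  exact ⟨s(a, b), by simpa using hab, by simp⟩

/-- The expected number `m = C(n, 2) p` of edges of `G_{n,p}`. -/
noncomputable def meanEdges (n : ℕ) (p : ℝ) : ℝ := (n.choose 2 : ℝ) * p

/-- The expected number `d = (n - 2) p ^ 2` of triangles on a given edge of `G_{n,p}`. -/
noncomputable def meanCodegree (n : ℕ) (p : ℝ) : ℝ := ((n : ℝ) - 2) * p ^ 2

/-- `ψ(d) = (1/2) [1 - exp(-(d/2) (1 + e^{-d}))]`. -/
noncomputable def psi (d : ℝ) : ℝ :=
  (1 / 2) * (1 - Real.exp (-(d / 2) * (1 + Real.exp (-d))))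

end TriangleCover

/-! Split the vertices into two halves `A` and `B`. The roughly m/2 edges inside the parts already
meet every triangle. The cover omits ("drops") an edge uv inside `A` if u and v have no common
neighbour in `B` and no w in `A` makes uvw a triangle whose other two edges also have no common
neighbour in `B`; likewise with the parts exchanged. A triangle meeting both parts keeps its inner
edge, and a triangle inside one part cannot lose all three edges (`tau_add_dropCount_le`).

An edge has no common neighbour across with probability about e^{-d/2}. Given disjoint
neighbourhoods of u and v in `B`, of total size about np, a vertex w spoils uv with probability
about p²(1-p)^{np} ≈ p²e^{-d}. The roughly n/2 candidates w act independently, since each is judged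
by its own pairs to `B` and {u, v}. So an edge is dropped with conditional probability about
exp(-(d/2)(1+e^{-d})), and ψ is half the complement. The averaging over neighbourhoods is the sum
`dropSum`, bounded below by Jensen (`le_dropSum`), so no concentration of degrees is needed.

For the variance, two edges without a shared endpoint are both dropped with probability at most
p²e^η `dropSum`², while one is dropped with probability at least pe^{-η} `dropSum`, where η = O(p).
The same `dropSum` occurs in both, so Chebyshev applies without evaluating it. -/

namespace TriangleCover

open MeasureTheory ProbabilityTheory

/-! ### Independence of events determined by disjoint sets of pairs -/

/-- The event `E` depends only on the edges in `D`. -/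
def EdgeDetermined {V : Type*} (D : Set (Sym2 V)) (E : Set (SimpleGraph V)) : Prop :=
  ∀ ⦃G G' : SimpleGraph V⦄, (∀ e ∈ D, e ∈ G.edgeSet ↔ e ∈ G'.edgeSet) → G ∈ E → G' ∈ E

theorem EdgeDetermined.inter {V : Type*} {D D' : Set (Sym2 V)} {E E' : Set (SimpleGraph V)}
    (h : EdgeDetermined D E) (h' : EdgeDetermined D' E') : EdgeDetermined (D ∪ D') (E ∩ E') :=
  fun _ _ hG hE => ⟨h (fun e he => hG e (Or.inl he)) hE.1, h' (fun e he => hG e (Or.inr he)) hE.2⟩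

theorem EdgeDetermined.biInter {V ι : Type*} {s : Finset ι} {D : ι → Set (Sym2 V)}
    {E : ι → Set (SimpleGraph V)} (h : ∀ i ∈ s, EdgeDetermined (D i) (E i)) :
    EdgeDetermined (⋃ i ∈ s, D i) (⋂ i ∈ s, E i) := by
  intro G G' hG hE
  simp only [Set.mem_iInter] at hE ⊢
  exact fun i hi => h i hi (fun e he => hG e (Set.mem_biUnion hi he)) (hE i hi)

instance instDiscreteMeasurableSpaceSimpleGraph {V : Type*} [Finite V] :
    DiscreteMeasurableSpace (SimpleGraph V) := by
  have : MeasurableSingletonClass (SimpleGraph V) := by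
    refine ⟨fun G => ?_⟩
    have h : ({G} : Set (SimpleGraph V)) = SimpleGraph.Adj ⁻¹' {G.Adj} := by
      ext H
      simp
    rw [h]
    exact SimpleGraph.measurable_adj (measurableSet_singleton _)
  infer_instance

section Independence

variable {V : Type*} [Finite V]

/-- `binomialRandom` is the image of a product measure with one coordinate per pair, and disjoint
families of independent coordinates are independent. -/
theorem measureReal_inter_of_disjoint (p : I) {D D' : Set (Sym2 V)} {E E' : Set (SimpleGraph V)}
    (h : EdgeDetermined D E) (h' : EdgeDetermined D' E') (hD : Disjoint D D') :
    (SimpleGraph.binomialRandom V p).real (E ∩ E') =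
      (SimpleGraph.binomialRandom V p).real E * (SimpleGraph.binomialRandom V p).real E' := by
  classical
  cases nonempty_fintype V
  set ν : Measure (Sym2 V → Prop) := Measure.infinitePi fun e : Sym2 V =>
    unitInterval.toNNReal p • Measure.dirac (e ∈ Sym2.diagSetᶜ) + unitInterval.toNNReal (σ p) • Measure.dirac False with hν
  let φ : (Sym2 V → Prop) → SimpleGraph V := fun x => SimpleGraph.fromEdgeSet {e | x e}
  have hφ : Measurable φ :=
    SimpleGraph.measurable_fromEdgeSet.comp MeasurableEquiv.setOfPred.measurable
  have hmap : SimpleGraph.binomialRandom V p = ν.map φ := by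
    rw [SimpleGraph.binomialRandom_eq_map, setBernoulli_eq_map, Measure.map_map]
    · rfl
    · fun_prop
    · fun_prop
  have hind : iIndepFun (fun (e : Sym2 V) (x : Sym2 V → Prop) => x e) ν :=
    iIndepFun_infinitePi (X := fun _ x => x) (by fun_prop)
  have hfin := hind.indepFun_finset D.toFinset D'.toFinset (by simpa using hD) (by fun_prop)
  -- An event determined by `D` is a cylinder: the preimage of its own image under restriction to
  -- the coordinates in `D`.
  have key : ∀ (D : Set (Sym2 V)) (E : Set (SimpleGraph V)), EdgeDetermined D E →
      φ ⁻¹' E = (fun (x : Sym2 V → Prop) (i : D.toFinset) => x i) ⁻¹'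
        ((fun (x : Sym2 V → Prop) (i : D.toFinset) => x i) '' (φ ⁻¹' E)) := by
    intro D E h
    refine Set.Subset.antisymm (Set.subset_preimage_image _ _) ?_
    rintro x ⟨y, hy, hxy⟩
    refine h (fun e he => ?_) hy
    have := congrFun hxy ⟨e, by simpa using he⟩
    simp only at this
    simp [φ, this]
  have := hfin.measure_inter_preimage_eq_mul
    ((fun (x : Sym2 V → Prop) (i : D.toFinset) => x i) '' (φ ⁻¹' E))
    ((fun (x : Sym2 V → Prop) (i : D'.toFinset) => x i) '' (φ ⁻¹' E')) 
    (Set.Finite.measurableSet (Set.toFinite _)) (Set.Finite.measurableSet (Set.toFinite _))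
  rw [← key D E h, ← key D' E' h'] at this
  simp only [measureReal_def, hmap]
  rw [Measure.map_apply hφ .of_discrete, Measure.map_apply hφ .of_discrete,
    Measure.map_apply hφ .of_discrete, Set.preimage_inter, this, ENNReal.toReal_mul]

theorem measureReal_biInter (p : I) {ι : Type*} (s : Finset ι) {D : ι → Set (Sym2 V)}
    {E : ι → Set (SimpleGraph V)} (h : ∀ i ∈ s, EdgeDetermined (D i) (E i))
    (hD : (s : Set ι).PairwiseDisjoint D) :
    (SimpleGraph.binomialRandom V p).real (⋂ i ∈ s, E i) =
      ∏ i ∈ s, (SimpleGraph.binomialRandom V p).real (E i) := by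
  classical
  induction s using Finset.induction_on with
  | empty => simp
  | insert a s ha ih =>
    rw [Finset.prod_insert ha, Finset.set_biInter_insert,
      measureReal_inter_of_disjoint p (h a (by simp))
        (EdgeDetermined.biInter fun i hi => h i (by simp [hi])),
      ih (fun i hi => h i (by simp [hi])) (hD.subset (by simp))]
    simp only [Set.disjoint_iUnion_right]
    intro i hi
    exact hD (by simp) (by simp [hi]) (by rintro rfl; exact ha hi)

omit [Finite V] in
theorem edgeDetermined_adj (u v : V) (P : Prop → Prop) :
    EdgeDetermined {s(u, v)} {G : SimpleGraph V | P (G.Adj u v)} := by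
  intro G G' h hG
  have := h s(u, v) rfl
  simp only [SimpleGraph.mem_edgeSet] at this
  simpa [this] using hG

theorem measureReal_adj (p : I) {u v : V} (h : u ≠ v) :
    (SimpleGraph.binomialRandom V p).real {G | G.Adj u v} = p := by
  classical
  rw [SimpleGraph.binomialRandom_eq_map, setBernoulli_eq_map,
    Measure.map_map (by fun_prop) (by fun_prop),
    measureReal_def, Measure.map_apply (by fun_prop) .of_discrete]
  have : ((SimpleGraph.fromEdgeSet ∘ fun p : Sym2 V → Prop => {i | p i}) ⁻¹' {G | G.Adj u v})
     = (fun x : Sym2 V → Prop => x s(u,v)) ⁻¹' {True} := by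
    ext x; simp [h]
  rw [this, ← Measure.map_apply (by fun_prop) .of_discrete, Measure.infinitePi_map_eval]
  simp [h]

theorem measureReal_not_adj (p : I) {u v : V} (h : u ≠ v) :
    (SimpleGraph.binomialRandom V p).real {G | ¬ G.Adj u v} = 1 - p := by
  have := probReal_compl_eq_one_sub (μ := SimpleGraph.binomialRandom V p)
    (s := {G | G.Adj u v}) .of_discrete
  rwa [measureReal_adj p h] at this

end Independence

/-! ### The events behind a dropped edge and the pairs that decide them -/

section Events

variable {V : Type*}

/-- The pairs joining `w` to the vertices of `X`. -/
def star (w : V) (X : Finset V) : Set (Sym2 V) := (fun z => s(w, z)) '' X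

theorem mem_star {w z : V} {X : Finset V} (h : z ∈ X) : s(w, z) ∈ star w X := ⟨z, h, rfl⟩

theorem star_disjoint {w u : V} {X Y : Finset V} (h : w ≠ u) (hw : w ∉ Y) :
    Disjoint (star w X) (star u Y) := by
  rw [Set.disjoint_left]
  rintro _ ⟨x, _, rfl⟩ ⟨y, hy, hxy⟩
  rcases Sym2.eq_iff.1 hxy with h' | h'
  · exact h h'.1.symm
  · exact hw (h'.2 ▸ hy)

theorem edgeDetermined_of_adj {D : Set (Sym2 V)} {E : Set (SimpleGraph V)}
    (h : ∀ G G' : SimpleGraph V, (∀ a b, s(a, b) ∈ D → (G.Adj a b ↔ G'.Adj a b)) →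
      G ∈ E → G' ∈ E) : EdgeDetermined D E :=
  fun G G' hG => h G G' fun a b hab => by simpa using hG s(a, b) hab

/-- The neighbourhood of `u` in `B` is `S`. -/
def nbrEvent (B : Finset V) (u : V) (S : Finset V) : Set (SimpleGraph V) :=
  {G | ∀ b ∈ B, (G.Adj u b ↔ b ∈ S)}

/-- `u` and `v` are adjacent, with neighbourhoods `P.1` and `P.2` in `B`. -/
def rootEvent (B : Finset V) (u v : V) (P : Finset V × Finset V) : Set (SimpleGraph V) :=
  nbrEvent B u P.1 ∩ (nbrEvent B v P.2 ∩ {G | G.Adj u v})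

/-- `w` is adjacent to `u` and `v`, but to no vertex in `S`. -/
def badEvent (S : Finset V) (u v w : V) : Set (SimpleGraph V) :=
  {G | G.Adj u w ∧ G.Adj v w ∧ ∀ b ∈ S, ¬ G.Adj w b}

/-- `uv` is an edge with no common neighbour in `B` and such that there is no `w ∈ A` for which
`uw` and `vw` are edges without common neighbours in `B`. -/
def dropEvent (A B : Finset V) (u v : V) : Set (SimpleGraph V) :=
  {G | G.Adj u v ∧ (∀ b ∈ B, ¬ (G.Adj u b ∧ G.Adj v b)) ∧
    ∀ w ∈ A, ¬ (G.Adj u w ∧ G.Adj v w ∧ (∀ b ∈ B, ¬ (G.Adj u b ∧ G.Adj w b)) ∧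
      ∀ b ∈ B, ¬ (G.Adj v b ∧ G.Adj w b))}

theorem edgeDetermined_nbrEvent (B : Finset V) (u : V) (S : Finset V) :
    EdgeDetermined (star u B) (nbrEvent B u S) :=
  edgeDetermined_of_adj fun _ _ h hG b hb => (h u b (mem_star hb)).symm.trans (hG b hb)

/-- The pair `uv` is assigned to the star of `u`, which therefore runs over `insert v B`. -/
theorem edgeDetermined_rootEvent [DecidableEq V] (B : Finset V) (u v : V)
    (P : Finset V × Finset V) :
    EdgeDetermined (star u (insert v B) ∪ star v B) (rootEvent B u v P) := by
  refine edgeDetermined_of_adj fun G G' h hG => ⟨fun b hb => ?_, fun b hb => ?_, ?_⟩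
  · exact (h u b (Or.inl (mem_star (by simp [hb])))).symm.trans (hG.1 b hb)
  · exact (h v b (Or.inr (mem_star hb))).symm.trans (hG.2.1 b hb)
  · exact (h u v (Or.inl (mem_star (by simp)))).1 hG.2.2

theorem edgeDetermined_badEvent {X S : Finset V} {u v : V} (w : V) (hu : u ∈ X) (hv : v ∈ X)
    (hS : S ⊆ X) : EdgeDetermined (star w X) (badEvent S u v w) := by
  refine edgeDetermined_of_adj fun G G' h hG => ⟨?_, ?_, fun b hb => ?_⟩
  · exact ((h w u (mem_star hu)).1 hG.1.symm).symm
  · exact ((h w v (mem_star hv)).1 hG.2.1.symm).symm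
  · exact fun hb' => hG.2.2 b hb ((h w b (mem_star (hS hb))).2 hb')

theorem EdgeDetermined.compl {D : Set (Sym2 V)} {E : Set (SimpleGraph V)}
    (h : EdgeDetermined D E) : EdgeDetermined D Eᶜ :=
  fun _ _ hG hE hE' => hE (h (fun e he => (hG e he).symm) hE')

/-- Pairs of disjoint subsets of `B`. -/
def disjointPairs [DecidableEq V] (B : Finset V) : Finset (Finset V × Finset V) :=
  {P ∈ B.powerset ×ˢ B.powerset | Disjoint P.1 P.2}

/-- The probability that two given vertices outside `B` have neighbourhoods `P.1`, `P.2` in `B`. -/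
noncomputable def rootWeight (x : ℝ) (B : Finset V) (P : Finset V × Finset V) : ℝ :=
  x ^ P.1.card * (1 - x) ^ (B.card - P.1.card) * (x ^ P.2.card * (1 - x) ^ (B.card - P.2.card))

theorem rootWeight_nonneg {x : ℝ} (h0 : 0 ≤ x) (h1 : x ≤ 1) (B : Finset V)
    (P : Finset V × Finset V) : 0 ≤ rootWeight x B P := by
  have : 0 ≤ 1 - x := by linarith
  unfold rootWeight
  positivity

end Events

/-! ### Drop probabilities as sums over neighbourhoods in `B` -/

section Probabilities

variable {V : Type*} [Finite V] [DecidableEq V] (p : I)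

theorem measureReal_nbrEvent {B S : Finset V} {u : V} (hu : u ∉ B) (hS : S ⊆ B) :
    (SimpleGraph.binomialRandom V p).real (nbrEvent B u S) =
      (p : ℝ) ^ S.card * (1 - p) ^ (B.card - S.card) := by
  have h : nbrEvent B u S = ⋂ b ∈ B, {G : SimpleGraph V | G.Adj u b ↔ b ∈ S} := by
    ext G
    simp [nbrEvent]
  have hub : ∀ b ∈ B, u ≠ b := fun b hb h => hu (h ▸ hb)
  rw [h, measureReal_biInter p B (fun b _ => edgeDetermined_adj u b (· ↔ b ∈ S))]
  · have : ∀ b ∈ B, (SimpleGraph.binomialRandom V p).real {G | G.Adj u b ↔ b ∈ S} =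
        if b ∈ S then (p : ℝ) else 1 - p := by
      intro b hb
      split_ifs with hbS
      · simpa [hbS] using measureReal_adj p (hub b hb)
      · simpa [hbS] using measureReal_not_adj p (hub b hb)
    rw [Finset.prod_congr rfl this, Finset.prod_ite, Finset.prod_const, Finset.prod_const,
      Finset.filter_mem_eq_inter, Finset.inter_eq_right.2 hS, Finset.filter_notMem_eq_sdiff,
      Finset.card_sdiff_of_subset hS]
  · intro a _ b hb hab
    simp only [Function.onFun, Set.disjoint_singleton, ne_eq, Sym2.eq_iff, not_or, not_and]
    exact ⟨fun _ => hab, fun h => absurd h (hub b hb)⟩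

theorem measureReal_rootEvent {B : Finset V} {u v : V} {P : Finset V × Finset V} (huv : u ≠ v)
    (hu : u ∉ B) (hv : v ∉ B) (hP : P ∈ disjointPairs B) :
    (SimpleGraph.binomialRandom V p).real (rootEvent B u v P) = rootWeight p B P * p := by
  simp only [disjointPairs, Finset.mem_filter, Finset.mem_product, Finset.mem_powerset] at hP
  have hadj : EdgeDetermined {s(u, v)} {G : SimpleGraph V | G.Adj u v} :=
    edgeDetermined_adj u v id
  rw [rootEvent, measureReal_inter_of_disjoint p (edgeDetermined_nbrEvent B u P.1)
      ((edgeDetermined_nbrEvent B v P.2).inter hadj),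
    measureReal_inter_of_disjoint p (edgeDetermined_nbrEvent B v P.2) hadj,
    measureReal_nbrEvent p hu hP.1.1, measureReal_nbrEvent p hv hP.1.2]
  · rw [measureReal_adj p huv, rootWeight]
    ring
  · rw [Set.disjoint_singleton_right]
    rintro ⟨b, hb, h⟩
    rcases Sym2.eq_iff.1 h with h | h
    · exact huv h.1.symm
    · exact hu (h.2 ▸ hb)
  · rw [Set.disjoint_union_right]
    refine ⟨star_disjoint huv hu, ?_⟩
    rw [Set.disjoint_singleton_right]
    rintro ⟨b, hb, h⟩
    rcases Sym2.eq_iff.1 h with h | h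
    · exact hv (h.2 ▸ hb)
    · exact huv h.1

theorem measureReal_biInter_adj {S : Finset V} {w : V} (h : w ∉ S) :
    (SimpleGraph.binomialRandom V p).real {G | ∀ z ∈ S, G.Adj w z} = (p : ℝ) ^ S.card := by
  rw [← mul_one ((p : ℝ) ^ S.card), ← pow_zero (1 - (p : ℝ)), ← Nat.sub_self S.card,
    ← measureReal_nbrEvent p h subset_rfl]
  congr 1
  ext G
  simp +contextual [nbrEvent]

theorem measureReal_badEvent {S : Finset V} {u v w : V} (huv : u ≠ v) (hu : u ∉ S) (hv : v ∉ S)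
    (hw : w ∉ S) (huw : u ≠ w) (hvw : v ≠ w) :
    (SimpleGraph.binomialRandom V p).real (badEvent S u v w) = (p : ℝ) ^ 2 * (1 - p) ^ S.card := by
  have h : badEvent S u v w = nbrEvent (insert u (insert v S)) w {u, v} := by
    ext G
    simp only [badEvent, nbrEvent, Set.mem_ofPred_eq, Finset.mem_insert, forall_eq_or_imp,
      Finset.mem_singleton, true_or, or_true, iff_true, G.adj_comm w u, G.adj_comm w v]
    refine and_congr_right fun _ => and_congr_right fun _ => forall₂_congr fun b hb => ?_
    have : b ≠ u := fun h => hu (h ▸ hb)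
    have : b ≠ v := fun h => hv (h ▸ hb)
    simp [*]
  rw [h, measureReal_nbrEvent p (by simp [hw, huw.symm, hvw.symm]) (by grind),
    Finset.card_pair huv, Finset.card_insert_of_notMem (by simp [huv, hu]),
    Finset.card_insert_of_notMem hv]
  simp

/-- Given neighbourhoods `P.1`, `P.2`, a vertex w adjacent to u and v spoils uv exactly when it has
no neighbour in `P.1 ∪ P.2`. This is decided by the star of w, and these stars are pairwise disjoint
and disjoint from the pairs deciding `rootEvent`. Distinct `P` give disjoint events, so the
probabilities add. -/
theorem measureReal_dropEvent_ge {A B : Finset V} (hAB : Disjoint A B) {u v : V} (hu : u ∈ A)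
    (hv : v ∈ A) (huv : u ≠ v) :
    (p : ℝ) * ∑ P ∈ disjointPairs B, rootWeight p B P *
        (1 - (p : ℝ) ^ 2 * (1 - p) ^ (P.1.card + P.2.card)) ^ (A.card - 2) ≤
      (SimpleGraph.binomialRandom V p).real (dropEvent A B u v) := by
  have hB : ∀ a ∈ A, a ∉ B := fun a ha => Finset.disjoint_left.1 hAB ha
  set W := (A.erase u).erase v with hW
  have hWA : ∀ w ∈ W, w ∈ A ∧ w ≠ u ∧ w ≠ v := by grind
  have hWc : W.card = A.card - 2 := by
    rw [hW, Finset.card_erase_of_mem (by grind), Finset.card_erase_of_mem hu]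
    rfl
  let E : Finset V × Finset V → Set (SimpleGraph V) := fun P =>
    rootEvent B u v P ∩ ⋂ w ∈ W, (badEvent (P.1 ∪ P.2) u v w)ᶜ
  have hsub : (⋃ P ∈ disjointPairs B, E P) ⊆ dropEvent A B u v := by
    intro G hG
    simp only [Set.mem_iUnion, E] at hG
    obtain ⟨P, hP, hG1, hG2⟩ := hG
    simp only [Set.mem_iInter, Set.mem_compl_iff, badEvent, Set.mem_ofPred_eq] at hG2
    simp only [disjointPairs, Finset.mem_filter, Finset.mem_product, Finset.mem_powerset] at hP
    obtain ⟨h1, h2, h3⟩ := hG1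
    refine ⟨h3, fun b hb h => ?_, fun w hw h => ?_⟩
    · exact Finset.disjoint_left.1 hP.2 ((h1 b hb).1 h.1) ((h2 b hb).1 h.2)
    -- The vertices u and v lie in `A` but cannot spoil uv, as there are no loops.
    · refine hG2 w (by
        have := h.1.ne
        have := h.2.1.ne
        grind) ⟨h.1, h.2.1, fun b hb hwb => ?_⟩
      rcases Finset.mem_union.1 hb with hb | hb
      · exact h.2.2.1 b (hP.1.1 hb) ⟨(h1 b (hP.1.1 hb)).2 hb, hwb⟩
      · exact h.2.2.2 b (hP.1.2 hb) ⟨(h2 b (hP.1.2 hb)).2 hb, hwb⟩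
  refine le_trans (le_of_eq ?_) (measureReal_mono hsub)
  rw [measureReal_biUnion_finset, Finset.mul_sum]
  · refine Finset.sum_congr rfl fun P hP => ?_
    have hP' := hP
    simp only [disjointPairs, Finset.mem_filter, Finset.mem_product, Finset.mem_powerset] at hP'
    have hPB : P.1 ∪ P.2 ⊆ B := Finset.union_subset hP'.1.1 hP'.1.2
    have hdet : ∀ w ∈ W, EdgeDetermined (star w (insert u (insert v B)))
        (badEvent (P.1 ∪ P.2) u v w)ᶜ := fun w _ =>
      (edgeDetermined_badEvent w (by simp) (by simp) (by grind)).compl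
    have hbad : ∀ w ∈ W, (SimpleGraph.binomialRandom V p).real (badEvent (P.1 ∪ P.2) u v w)ᶜ =
        1 - (p : ℝ) ^ 2 * (1 - p) ^ (P.1.card + P.2.card) := by
      intro w hw
      obtain ⟨hwA, hwu, hwv⟩ := hWA w hw
      rw [probReal_compl_eq_one_sub .of_discrete, measureReal_badEvent p huv
        (fun h => hB u hu (hPB h)) (fun h => hB v hv (hPB h)) (fun h => hB w hwA (hPB h)) hwu.symm
        hwv.symm, Finset.card_union_of_disjoint hP'.2]
    rw [measureReal_inter_of_disjoint p (edgeDetermined_rootEvent B u v P)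
        (EdgeDetermined.biInter hdet), measureReal_rootEvent p huv (hB u hu) (hB v hv) hP,
      measureReal_biInter p W hdet, Finset.prod_congr rfl hbad, Finset.prod_const, hWc]
    · ring
    · intro w hw w' hw' hww'
      have := hWA w hw
      have := hB w
      exact star_disjoint hww' (by grind)
    · simp only [Set.disjoint_iUnion_right]
      intro w hw
      have := hWA w hw
      have := hB w
      rw [Set.disjoint_union_left]
      exact ⟨(star_disjoint (by grind) (by grind)).symm,
        (star_disjoint (by grind) (by grind)).symm⟩
  · intro P hP Q hQ hPQ
    refine Set.disjoint_left.2 fun G hG hG' => hPQ ?_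
    simp only [disjointPairs, Finset.coe_filter, Finset.mem_product, Finset.mem_powerset,
      Set.mem_ofPred_eq] at hP hQ
    obtain ⟨⟨h1, h2, -⟩, -⟩ := hG
    obtain ⟨⟨h1', h2', -⟩, -⟩ := hG'
    refine Prod.ext ?_ ?_ <;> ext b
    · exact ⟨fun h => (h1' b (hP.1.1 h)).1 ((h1 b (hP.1.1 h)).2 h),
        fun h => (h1 b (hQ.1.1 h)).1 ((h1' b (hQ.1.1 h)).2 h)⟩
    · exact ⟨fun h => (h2' b (hP.1.2 h)).1 ((h2 b (hP.1.2 h)).2 h),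
        fun h => (h2 b (hQ.1.2 h)).1 ((h2' b (hQ.1.2 h)).2 h)⟩
  · exact fun _ _ => .of_discrete

/-- With four distinct endpoints the two root events use disjoint pairs, and a union bound over `P`
and `Q` suffices. Each further w must spoil neither edge; spoiling both forces adjacency to all four
endpoints, whence the correction p⁴ in inclusion-exclusion. -/
theorem measureReal_dropEvent_inter_le {A B : Finset V} (hAB : Disjoint A B) {u v x y : V}
    (hu : u ∈ A) (hv : v ∈ A) (hx : x ∈ A) (hy : y ∈ A) (huv : u ≠ v) (hxy : x ≠ y)
    (hux : u ≠ x) (huy : u ≠ y) (hvx : v ≠ x) (hvy : v ≠ y) :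
    (SimpleGraph.binomialRandom V p).real (dropEvent A B u v ∩ dropEvent A B x y) ≤
      (p : ℝ) ^ 2 * ∑ P ∈ disjointPairs B, ∑ Q ∈ disjointPairs B,
        rootWeight p B P * rootWeight p B Q *
          (1 - (p : ℝ) ^ 2 * (1 - p) ^ (P.1.card + P.2.card) -
            (p : ℝ) ^ 2 * (1 - p) ^ (Q.1.card + Q.2.card) + (p : ℝ) ^ 4) ^ (A.card - 4) := by
  have hB : ∀ a ∈ A, a ∉ B := fun a ha => Finset.disjoint_left.1 hAB ha
  set W := A \ {u, v, x, y} with hW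
  have hWA : ∀ w ∈ W, w ∈ A ∧ w ≠ u ∧ w ≠ v ∧ w ≠ x ∧ w ≠ y := by grind
  have hR : ({u, v, x, y} : Finset V).card = 4 := by
    rw [Finset.card_insert_of_notMem (by grind), Finset.card_insert_of_notMem (by grind),
      Finset.card_pair hxy]
  have hWc : W.card = A.card - 4 := by
    rw [hW, Finset.card_sdiff_of_subset (by grind), hR]
  let bad : Finset V × Finset V → Finset V × Finset V → V → Set (SimpleGraph V) := fun P Q w =>
    (badEvent (P.1 ∪ P.2) u v w ∪ badEvent (Q.1 ∪ Q.2) x y w)ᶜ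
  let E : Finset V × Finset V → Finset V × Finset V → Set (SimpleGraph V) := fun P Q =>
    rootEvent B u v P ∩ (rootEvent B x y Q ∩ ⋂ w ∈ W, bad P Q w)
  have hsub : dropEvent A B u v ∩ dropEvent A B x y ⊆
      ⋃ P ∈ disjointPairs B, ⋃ Q ∈ disjointPairs B, E P Q := by
    classical
    have key : ∀ (G : SimpleGraph V) (u v : V), G ∈ dropEvent A B u v →
        ∃ P ∈ disjointPairs B, G ∈ rootEvent B u v P ∧
          ∀ w ∈ A, G ∉ badEvent (P.1 ∪ P.2) u v w := by
      rintro G u v ⟨h1, h2, h3⟩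
      refine ⟨({b ∈ B | G.Adj u b}, {b ∈ B | G.Adj v b}), ?_, ⟨?_, ?_, h1⟩, ?_⟩
      · simp only [disjointPairs, Finset.mem_filter, Finset.mem_product, Finset.mem_powerset,
          Finset.filter_subset, and_self, true_and]
        rw [Finset.disjoint_filter]
        exact fun b hb h h' => h2 b hb ⟨h, h'⟩
      · intro b hb
        simp [hb]
      · intro b hb
        simp [hb]
      · rintro w hw ⟨h4, h5, h6⟩
        refine h3 w hw ⟨h4, h5, fun b hb h => h6 b ?_ h.2, fun b hb h => h6 b ?_ h.2⟩
        · simp [hb, h.1]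
        · simp [hb, h.1]
    rintro G ⟨hG, hG'⟩
    obtain ⟨P, hP, h1, h2⟩ := key G u v hG
    obtain ⟨Q, hQ, h3, h4⟩ := key G x y hG'
    simp only [Set.mem_iUnion]
    refine ⟨P, hP, Q, hQ, h1, h3, ?_⟩
    simp only [Set.mem_iInter, bad, Set.mem_compl_iff, Set.mem_union, not_or]
    exact fun w hw => ⟨h2 w (hWA w hw).1, h4 w (hWA w hw).1⟩
  refine (measureReal_mono hsub (measure_ne_top _ _)).trans ((measureReal_biUnion_finset_le _ _).trans ?_)
  rw [Finset.mul_sum]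
  refine Finset.sum_le_sum fun P hP => (measureReal_biUnion_finset_le _ _).trans ?_
  rw [Finset.mul_sum]
  refine Finset.sum_le_sum fun Q hQ => ?_
  have hP' := hP
  have hQ' := hQ
  simp only [disjointPairs, Finset.mem_filter, Finset.mem_product, Finset.mem_powerset] at hP' hQ'
  have hPB : P.1 ∪ P.2 ⊆ B := Finset.union_subset hP'.1.1 hP'.1.2
  have hQB : Q.1 ∪ Q.2 ⊆ B := Finset.union_subset hQ'.1.1 hQ'.1.2
  let X : Finset V := {u, v, x, y} ∪ B
  have hdet : ∀ w ∈ W, EdgeDetermined (star w X) (bad P Q w) := by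
    intro w _
    have h1 : EdgeDetermined (star w X) (badEvent (P.1 ∪ P.2) u v w)ᶜ :=
      (edgeDetermined_badEvent w (by simp [X]) (by simp [X]) (by grind)).compl
    have h2 : EdgeDetermined (star w X) (badEvent (Q.1 ∪ Q.2) x y w)ᶜ :=
      (edgeDetermined_badEvent w (by simp [X]) (by simp [X]) (by grind)).compl
    have := h1.inter h2
    rwa [Set.union_self, ← Set.compl_union] at this
  have hbad : ∀ w ∈ W, (SimpleGraph.binomialRandom V p).real (bad P Q w) ≤
      1 - (p : ℝ) ^ 2 * (1 - p) ^ (P.1.card + P.2.card) -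
            (p : ℝ) ^ 2 * (1 - p) ^ (Q.1.card + Q.2.card) + (p : ℝ) ^ 4 := by
    intro w hw
    obtain ⟨hwA, hwu, hwv, hwx, hwy⟩ := hWA w hw
    have h1 := measureReal_badEvent p huv (fun h => hB u hu (hPB h)) (fun h => hB v hv (hPB h))
      (fun h => hB w hwA (hPB h)) hwu.symm hwv.symm
    have h2 := measureReal_badEvent p hxy (fun h => hB x hx (hQB h)) (fun h => hB y hy (hQB h))
      (fun h => hB w hwA (hQB h)) hwx.symm hwy.symm
    rw [Finset.card_union_of_disjoint hP'.2] at h1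
    rw [Finset.card_union_of_disjoint hQ'.2] at h2
    have h3 := measureReal_union_add_inter (μ := SimpleGraph.binomialRandom V p)
      (s := badEvent (P.1 ∪ P.2) u v w) (t := badEvent (Q.1 ∪ Q.2) x y w) .of_discrete
    have h4 : (SimpleGraph.binomialRandom V p).real
        (badEvent (P.1 ∪ P.2) u v w ∩ badEvent (Q.1 ∪ Q.2) x y w) ≤ (p : ℝ) ^ 4 := by
      have h5 := measureReal_biInter_adj p (S := {u, v, x, y}) (w := w) (by simp [*])
      rw [hR] at h5
      rw [← h5]
      refine measureReal_mono ?_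
      rintro G ⟨⟨a, b, -⟩, ⟨c, d, -⟩⟩
      simp [a.symm, b.symm, c.symm, d.symm]
    simp only [bad]
    rw [probReal_compl_eq_one_sub .of_discrete]
    linarith
  simp only [E]
  rw [measureReal_inter_of_disjoint p (edgeDetermined_rootEvent B u v P)
      ((edgeDetermined_rootEvent B x y Q).inter (EdgeDetermined.biInter hdet)),
    measureReal_inter_of_disjoint p (edgeDetermined_rootEvent B x y Q)
      (EdgeDetermined.biInter hdet),
    measureReal_rootEvent p huv (hB u hu) (hB v hv) hP,
    measureReal_rootEvent p hxy (hB x hx) (hB y hy) hQ, measureReal_biInter p W hdet]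
  · have h1 := Finset.prod_le_prod (fun w _ => measureReal_nonneg) hbad
    rw [Finset.prod_const, hWc] at h1
    have h2 := rootWeight_nonneg p.2.1 p.2.2 B P
    have h3 := rootWeight_nonneg p.2.1 p.2.2 B Q
    have h4 : 0 ≤ (p : ℝ) ^ 2 * (rootWeight p B P * rootWeight p B Q) := by positivity
    calc _ = (p : ℝ) ^ 2 * (rootWeight p B P * rootWeight p B Q) *
          ∏ w ∈ W, (SimpleGraph.binomialRandom V p).real (bad P Q w) := by ring
      _ ≤ _ := mul_le_mul_of_nonneg_left h1 h4
      _ = _ := by ring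
  · intro w hw w' hw' hww'
    have := hWA w hw
    have := hB w
    exact star_disjoint hww' (by grind)
  · simp only [Set.disjoint_iUnion_right]
    intro w hw
    have := hWA w hw
    have := hB w
    rw [Set.disjoint_union_left]
    exact ⟨(star_disjoint (by grind) (by grind)).symm,
      (star_disjoint (by grind) (by grind)).symm⟩
  · simp only [Set.disjoint_union_right, Set.disjoint_union_left, Set.disjoint_iUnion_right]
    have h1 := hB u hu
    have h2 := hB v hv
    have h3 := hB x hx
    have h4 := hB y hy
    refine ⟨⟨⟨?_, ?_⟩, ?_, ?_⟩, fun w hw => ?_⟩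
    · exact star_disjoint hux (by grind)
    · exact star_disjoint hvx (by grind)
    · exact star_disjoint huy (by grind)
    · exact star_disjoint hvy (by grind)
    · have := hWA w hw
      have := hB w
      exact ⟨(star_disjoint (by grind) (by grind)).symm,
        (star_disjoint (by grind) (by grind)).symm⟩

end Probabilities

/-! ### Estimates for the sums over neighbourhoods -/

/-- Each vertex of `B` contributes one factor: (1-x)² if it lies in neither set, 2x(1-x)c if it lies
in exactly one; lying in both is excluded. -/
theorem sum_rootWeight_mul_pow {V : Type*} [DecidableEq V] (B : Finset V) (x c : ℝ) :
    ∑ P ∈ disjointPairs B, rootWeight x B P * c ^ (P.1.card + P.2.card) =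
      ((1 - x) * (1 - x + 2 * x * c)) ^ B.card := by
  rw [disjointPairs, Finset.sum_filter, Finset.sum_product]
  have h1 : ∀ S ∈ B.powerset, (∑ T ∈ B.powerset, if Disjoint S T then
      rootWeight x B (S, T) * c ^ (S.card + T.card) else 0) =
      (x * c * (1 - x)) ^ S.card * ((1 - x) * (x * c + (1 - x))) ^ (B.card - S.card) := by
    intro S hS
    rw [Finset.mem_powerset] at hS
    have hc : (B \ S).card = B.card - S.card := Finset.card_sdiff_of_subset hS
    have hSB := Finset.card_le_card hS
    rw [mul_pow (1 - x), ← hc, ← Finset.sum_pow_mul_eq_add_pow, hc, ← Finset.sum_filter]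
    rw [show {T ∈ B.powerset | Disjoint S T} = (B \ S).powerset by
      ext T
      simp only [Finset.mem_filter, Finset.mem_powerset, Finset.subset_sdiff]
      exact and_congr_right fun _ => disjoint_comm, Finset.mul_sum, Finset.mul_sum]
    refine Finset.sum_congr rfl fun T hT => ?_
    have hT' := Finset.card_le_card (Finset.mem_powerset.1 hT)
    rw [hc] at hT'
    rw [rootWeight, show B.card - T.card = S.card + (B.card - S.card - T.card) by omega, pow_add,
      pow_add, mul_pow, mul_pow, mul_pow]
    ring
  rw [Finset.sum_congr rfl h1, Finset.sum_pow_mul_eq_add_pow]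
  congr 1
  ring

/-- Up to a factor close to `1`, the probability that a given edge is dropped. -/
noncomputable def dropSum {V : Type*} [DecidableEq V] (K x : ℝ) (B : Finset V) : ℝ :=
  ∑ P ∈ disjointPairs B, rootWeight x B P *
    Real.exp (-(K * (x ^ 2 * (1 - x) ^ (P.1.card + P.2.card))))

theorem dropSum_nonneg {V : Type*} [DecidableEq V] {K x : ℝ} (B : Finset V) (h0 : 0 ≤ x)
    (h1 : x ≤ 1) : 0 ≤ dropSum K x B :=
  Finset.sum_nonneg fun P _ => mul_nonneg (rootWeight_nonneg h0 h1 B P) (Real.exp_pos _).le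

theorem dropSum_le_one {V : Type*} [DecidableEq V] {K x : ℝ} (B : Finset V) (hK : 0 ≤ K)
    (h0 : 0 ≤ x) (h1 : x ≤ 1) : dropSum K x B ≤ 1 := by
  have h2 := sum_rootWeight_mul_pow B x 1
  simp only [one_pow, mul_one] at h2
  have h3 : 0 ≤ 1 - x := by linarith
  calc dropSum K x B ≤ ∑ P ∈ disjointPairs B, rootWeight x B P := by
        refine Finset.sum_le_sum fun P _ =>
          mul_le_of_le_one_right (rootWeight_nonneg h0 h1 B P) ?_
        rw [Real.exp_le_one_iff]
        have : 0 ≤ K * (x ^ 2 * (1 - x) ^ (P.1.card + P.2.card)) := by positivity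
        linarith
    _ ≤ 1 := by
        rw [h2]
        exact pow_le_one₀ (by nlinarith) (by nlinarith)

/-- Jensen's inequality. The generating function at c = 1 gives the total weight (1-x²)^|B|, and at
c = 1-x it shows that (1-2x²/(1+x))^|B| is the weighted mean of (1-x)^(|P.1|+|P.2|). -/
theorem le_dropSum {V : Type*} [DecidableEq V] (K : ℝ) {x : ℝ} (B : Finset V)
    (h0 : 0 ≤ x) (h1 : x < 1) :
    (1 - x ^ 2) ^ B.card * Real.exp (-(K * (x ^ 2 * (1 - 2 * x ^ 2 / (1 + x)) ^ B.card))) ≤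
      dropSum K x B := by
  set q := (1 - 2 * x ^ 2 / (1 + x)) ^ B.card with hq
  set s := K * (x ^ 2 * q) with hs
  have e1 := sum_rootWeight_mul_pow B x 1
  have e2 := sum_rootWeight_mul_pow B x (1 - x)
  simp only [one_pow, mul_one] at e1
  have hr : ((1 - x) * (1 - x + 2 * x)) = 1 - x ^ 2 := by ring
  have hrq : (1 - x) * (1 - x + 2 * x * (1 - x)) = (1 - x ^ 2) * (1 - 2 * x ^ 2 / (1 + x)) := by
    field_simp
    ring
  rw [hr] at e1
  rw [hrq, mul_pow, ← hq] at e2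
  -- The tangent line of e^{-y} at y = s, where s is the mean of y; the linear terms cancel on
  -- summation.
  have key : ∀ P ∈ disjointPairs B, rootWeight x B P * (Real.exp (-s) * (1 + s)) -
      rootWeight x B P * (1 - x) ^ (P.1.card + P.2.card) * (Real.exp (-s) * K * x ^ 2) ≤
      rootWeight x B P * Real.exp (-(K * (x ^ 2 * (1 - x) ^ (P.1.card + P.2.card)))) := by
    intro P _
    have h2 := Real.add_one_le_exp (s - K * (x ^ 2 * (1 - x) ^ (P.1.card + P.2.card)))
    have h3 := mul_le_mul_of_nonneg_left h2
      (mul_nonneg (rootWeight_nonneg h0 h1.le B P) (Real.exp_pos (-s)).le)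
    rw [mul_assoc (rootWeight x B P) (Real.exp (-s)) (Real.exp _), ← Real.exp_add,
      show -s + (s - K * (x ^ 2 * (1 - x) ^ (P.1.card + P.2.card))) =
        -(K * (x ^ 2 * (1 - x) ^ (P.1.card + P.2.card))) by ring] at h3
    linarith
  refine le_trans (le_of_eq ?_) (Finset.sum_le_sum key)
  rw [Finset.sum_sub_distrib, ← Finset.sum_mul, ← Finset.sum_mul, e1, e2, hs]
  ring

theorem exp_neg_le_one_sub {t : ℝ} (h1 : t ≤ 1 / 2) :
    Real.exp (-(t + 2 * t ^ 2)) ≤ 1 - t := by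
  rw [Real.exp_neg]
  have h2 := Real.add_one_le_exp (t + 2 * t ^ 2)
  refine inv_le_of_inv_le₀ (by linarith) (le_trans ?_ h2)
  rw [inv_le_iff_one_le_mul₀ (by linarith)]
  nlinarith [mul_nonneg (sq_nonneg t) (by linarith : 0 ≤ 1 - 2 * t)]

/-- The error exponent in the estimates for the probability that edges are dropped. -/
noncomputable def dropError (K x : ℝ) : ℝ := 8 * x ^ 2 + 2 * K * x ^ 4

section

variable {V : Type*} [Finite V] [DecidableEq V] (p : I)

theorem measureReal_dropEvent_ge_dropSum {A B : Finset V} (hAB : Disjoint A B) {u v : V}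
    (hu : u ∈ A) (hv : v ∈ A) (huv : u ≠ v) (hp : (p : ℝ) ≤ 1 / 2) :
    p * (Real.exp (-dropError A.card p) * dropSum A.card p B) ≤
      (SimpleGraph.binomialRandom V p).real (dropEvent A B u v) := by
  have hp0 : (0 : ℝ) ≤ p := p.2.1
  refine le_trans (mul_le_mul_of_nonneg_left ?_ hp0) (measureReal_dropEvent_ge p hAB hu hv huv)
  rw [dropSum, Finset.mul_sum]
  refine Finset.sum_le_sum fun P _ => ?_
  rw [mul_left_comm]
  refine mul_le_mul_of_nonneg_left ?_ (rootWeight_nonneg hp0 p.2.2 B P)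
  set t := (p : ℝ) ^ 2 * (1 - p) ^ (P.1.card + P.2.card) with ht
  have hpow : (1 - (p : ℝ)) ^ (P.1.card + P.2.card) ≤ 1 := pow_le_one₀ (by linarith) (by linarith)
  have hpow0 : 0 ≤ (1 - (p : ℝ)) ^ (P.1.card + P.2.card) := pow_nonneg (by linarith) _
  have ht0 : 0 ≤ t := by positivity
  have htp : t ≤ (p : ℝ) ^ 2 := mul_le_of_le_one_right (by positivity) hpow
  have ht1 : t ≤ 1 / 2 := by nlinarith
  have ht2 : t ^ 2 ≤ (p : ℝ) ^ 4 := by nlinarith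
  calc Real.exp (-dropError A.card p) * Real.exp (-(A.card * t))
      ≤ Real.exp (A.card * -(t + 2 * t ^ 2)) := by
        rw [← Real.exp_add, Real.exp_le_exp, dropError]
        have : (A.card : ℝ) * t ^ 2 ≤ A.card * (p : ℝ) ^ 4 := by gcongr
        nlinarith [sq_nonneg (p : ℝ)]
    _ = Real.exp (-(t + 2 * t ^ 2)) ^ A.card := Real.exp_nat_mul _ _
    _ ≤ (1 - t) ^ A.card :=
        pow_le_pow_left₀ (Real.exp_pos _).le (exp_neg_le_one_sub ht1) _
    -- The base lies in [0, 1], so a smaller exponent gives a larger power.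
    _ ≤ (1 - t) ^ (A.card - 2) :=
        pow_le_pow_of_le_one (by linarith) (by linarith) (Nat.sub_le _ _)

theorem measureReal_dropEvent_inter_le_dropSum {A B : Finset V} (hAB : Disjoint A B) {u v x y : V}
    (hu : u ∈ A) (hv : v ∈ A) (hx : x ∈ A) (hy : y ∈ A) (huv : u ≠ v) (hxy : x ≠ y)
    (hux : u ≠ x) (huy : u ≠ y) (hvx : v ≠ x) (hvy : v ≠ y) :
    (SimpleGraph.binomialRandom V p).real (dropEvent A B u v ∩ dropEvent A B x y) ≤
      (p : ℝ) ^ 2 * (Real.exp (dropError A.card p) * dropSum A.card p B ^ 2) := by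
  have hp0 : (0 : ℝ) ≤ p := p.2.1
  have hp1 : (p : ℝ) ≤ 1 := p.2.2
  have hA : 4 ≤ A.card := by
    have hR : ({u, v, x, y} : Finset V).card = 4 := by
      rw [Finset.card_insert_of_notMem (by grind), Finset.card_insert_of_notMem (by grind),
        Finset.card_pair hxy]
    rw [← hR]
    exact Finset.card_le_card (by grind)
  refine (measureReal_dropEvent_inter_le p hAB hu hv hx hy huv hxy hux huy hvx hvy).trans
    (mul_le_mul_of_nonneg_left ?_ (by positivity))
  rw [dropSum, pow_two (Finset.sum _ _), Finset.sum_mul_sum, Finset.mul_sum]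
  refine Finset.sum_le_sum fun P _ => ?_
  rw [Finset.mul_sum]
  refine Finset.sum_le_sum fun Q _ => ?_
  have key : ∀ k : ℕ, 0 ≤ (p : ℝ) ^ 2 * (1 - p) ^ k ∧ (p : ℝ) ^ 2 * (1 - p) ^ k ≤ (p : ℝ) ^ 2 := by
    intro k
    have h1 : (1 - (p : ℝ)) ^ k ≤ 1 := pow_le_one₀ (by linarith) (by linarith)
    have h2 : 0 ≤ (1 - (p : ℝ)) ^ k := pow_nonneg (by linarith) _
    exact ⟨by positivity, mul_le_of_le_one_right (by positivity) h1⟩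
  obtain ⟨a0, a1⟩ := key (P.1.card + P.2.card)
  obtain ⟨b0, b1⟩ := key (Q.1.card + Q.2.card)
  set a := (p : ℝ) ^ 2 * (1 - p) ^ (P.1.card + P.2.card)
  set b := (p : ℝ) ^ 2 * (1 - p) ^ (Q.1.card + Q.2.card)
  have h2 := rootWeight_nonneg hp0 hp1 B P
  have h3 := rootWeight_nonneg hp0 hp1 B Q
  have hbase : 0 ≤ 1 - a - b + (p : ℝ) ^ 4 := by nlinarith [sq_nonneg ((p : ℝ) ^ 2 - 1)]
  calc rootWeight p B P * rootWeight p B Q * (1 - a - b + (p : ℝ) ^ 4) ^ (A.card - 4)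
      ≤ rootWeight p B P * rootWeight p B Q * Real.exp (dropError A.card p + (-(A.card * a)) +
          (-(A.card * b))) := by
        refine mul_le_mul_of_nonneg_left ?_ (by positivity)
        have h4 := Real.add_one_le_exp (-a - b + (p : ℝ) ^ 4)
        calc (1 - a - b + (p : ℝ) ^ 4) ^ (A.card - 4)
            ≤ Real.exp (-a - b + (p : ℝ) ^ 4) ^ (A.card - 4) :=
              pow_le_pow_left₀ hbase (by linarith) _
          _ = Real.exp ((A.card - 4 : ℕ) * (-a - b + (p : ℝ) ^ 4)) := (Real.exp_nat_mul _ _).symm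
          _ ≤ _ := by
              -- The four missing factors cost at most 4(a+b) ≤ 8p², and the p⁴ in the remaining
              -- ones at most |A|p⁴.
              rw [Real.exp_le_exp, dropError, Nat.cast_sub hA]
              have h5 : 0 ≤ (A.card : ℝ) * (p : ℝ) ^ 4 := by positivity
              have h6 : (0 : ℝ) ≤ (p : ℝ) ^ 4 := by positivity
              push_cast
              nlinarith
    _ = _ := by
        rw [Real.exp_add, Real.exp_add]
        ring

end

/-! ### Chebyshev's inequality for counts of events -/

section SecondMoment

variable {Ω ι : Type*} [MeasurableSpace Ω] [DiscreteMeasurableSpace Ω] [Finite Ω]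

open Classical in
/-- The number of the events `E i`, `i ∈ s`, that occur. -/
noncomputable def eventCount (s : Finset ι) (E : ι → Set Ω) (ω : Ω) : ℕ :=
  {i ∈ s | ω ∈ E i}.card

omit [MeasurableSpace Ω] [DiscreteMeasurableSpace Ω] [Finite Ω] in
theorem eventCount_eq_sum_indicator (s : Finset ι) (E : ι → Set Ω) (ω : Ω) :
    (eventCount s E ω : ℝ) = ∑ i ∈ s, (E i).indicator 1 ω := by
  classical
  simp [eventCount, Set.indicator_apply]

theorem measureReal_le_abs_eventCount_sub (μ : Measure Ω) [IsProbabilityMeasure μ] (s : Finset ι)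
    (E : ι → Set Ω) {t : ℝ} (ht : 0 < t) :
    μ.real {ω | t ≤ |(eventCount s E ω : ℝ) - ∑ i ∈ s, μ.real (E i)|} ≤
      (∑ i ∈ s, ∑ j ∈ s, μ.real (E i ∩ E j) - (∑ i ∈ s, μ.real (E i)) ^ 2) / t ^ 2 := by
  set m := ∑ i ∈ s, μ.real (E i) with hm
  have hint : ∀ f : Ω → ℝ, Integrable f μ := fun f => .of_finite
  have h1 : ∫ ω, (eventCount s E ω : ℝ) ∂μ = m := by
    simp_rw [eventCount_eq_sum_indicator]
    rw [integral_finsetSum _ fun i _ => hint _]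
    exact Finset.sum_congr rfl fun i _ => integral_indicator_one .of_discrete
  have h2 : ∫ ω, (eventCount s E ω : ℝ) ^ 2 ∂μ = ∑ i ∈ s, ∑ j ∈ s, μ.real (E i ∩ E j) := by
    simp_rw [eventCount_eq_sum_indicator, sq, Finset.sum_mul_sum]
    rw [integral_finsetSum _ fun i _ => hint _]
    refine Finset.sum_congr rfl fun i _ => ?_
    rw [integral_finsetSum _ fun i _ => hint _]
    refine Finset.sum_congr rfl fun j _ => ?_
    rw [← integral_indicator_one (.of_discrete), Set.inter_indicator_one]
    rfl
  have h3 : ∫ ω, ((eventCount s E ω : ℝ) - m) ^ 2 ∂μ =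
      ∑ i ∈ s, ∑ j ∈ s, μ.real (E i ∩ E j) - m ^ 2 := by
    have : ∀ ω, ((eventCount s E ω : ℝ) - m) ^ 2 =
        (eventCount s E ω : ℝ) ^ 2 - 2 * m * eventCount s E ω + m ^ 2 := fun ω => by ring
    simp_rw [this]
    rw [integral_add (hint _) (hint _), integral_sub (hint _) (hint _), integral_const_mul, h1, h2]
    simp
    ring
  have h4 := mul_meas_ge_le_integral_of_nonneg (μ := μ)
    (f := fun ω => ((eventCount s E ω : ℝ) - m) ^ 2) (.of_forall fun ω => sq_nonneg _) (hint _)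
    (t ^ 2)
  rw [h3] at h4
  rw [le_div_iff₀ (by positivity), mul_comm]
  simpa only [sq_le_sq, abs_of_pos ht] using h4

end SecondMoment

/-! ### The cover and its size -/

section

variable {V : Type*} [LinearOrder V]

/-- The pairs of vertices in `A`, in increasing order. -/
def innerPairs (A : Finset V) : Finset (V × V) := {e ∈ A ×ˢ A | e.1 < e.2}

theorem mem_innerPairs {A : Finset V} {e : V × V} :
    e ∈ innerPairs A ↔ (e.1 ∈ A ∧ e.2 ∈ A) ∧ e.1 < e.2 := by
  simp [innerPairs]

theorem card_innerPairs (A : Finset V) :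
    ((innerPairs A).card : ℝ) = A.card * (A.card - 1) / 2 := by
  have h1 : A.offDiag = innerPairs A ∪ (innerPairs A).map (Equiv.prodComm V V).toEmbedding := by
    ext ⟨a, b⟩
    simp only [Finset.mem_offDiag, Finset.mem_union, mem_innerPairs, Finset.mem_map_equiv,
      Equiv.prodComm_symm, Equiv.prodComm_apply, Prod.fst_swap, Prod.snd_swap]
    constructor
    · rintro ⟨ha, hb, hab⟩
      exact (lt_or_gt_of_ne hab).imp (fun h => ⟨⟨ha, hb⟩, h⟩) (fun h => ⟨⟨hb, ha⟩, h⟩)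
    · rintro (⟨⟨ha, hb⟩, h⟩ | ⟨⟨hb, ha⟩, h⟩)
      · exact ⟨ha, hb, h.ne⟩
      · exact ⟨ha, hb, h.ne'⟩
  have h2 : Disjoint (innerPairs A) ((innerPairs A).map (Equiv.prodComm V V).toEmbedding) := by
    rw [Finset.disjoint_left]
    rintro ⟨a, b⟩ h h'
    simp only [mem_innerPairs, Finset.mem_map_equiv, Equiv.prodComm_symm, Equiv.prodComm_apply,
      Prod.fst_swap, Prod.snd_swap] at h h'
    exact lt_asymm h.2 h'.2
  have h3 := congrArg Finset.card h1
  rw [Finset.card_union_of_disjoint h2, Finset.card_map, Finset.offDiag_card] at h3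
  have h4 : A.card ≤ A.card * A.card := Nat.le_mul_self _
  have h5 : (innerPairs A).card + (innerPairs A).card + A.card = A.card * A.card := by omega
  have h6 : ((innerPairs A).card : ℝ) + (innerPairs A).card + A.card = A.card * A.card := by
    exact_mod_cast h5
  linarith

/-- The number of edges of `G` inside `A`. -/
noncomputable def edgeCount (A : Finset V) (G : SimpleGraph V) : ℕ :=
  eventCount (innerPairs A) (fun e => {G | G.Adj e.1 e.2}) G

/-- The number of dropped edges of `G` inside `A`. -/
noncomputable def dropCount (A B : Finset V) (G : SimpleGraph V) : ℕ :=
  eventCount (innerPairs A) (fun e => dropEvent A B e.1 e.2) G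

omit [LinearOrder V] in
theorem dropEvent_symm {A B : Finset V} {u v : V} {G : SimpleGraph V}
    (h : G ∈ dropEvent A B u v) : G ∈ dropEvent A B v u :=
  ⟨h.1.symm, fun b hb hb' => h.2.1 b hb hb'.symm,
    fun w hw hw' => h.2.2 w hw ⟨hw'.2.1, hw'.1, hw'.2.2.2, hw'.2.2.1⟩⟩

open Classical in
/-- The edges inside `A` that are not dropped. -/
noncomputable def keptEdges (A B : Finset V) (G : SimpleGraph V) : Finset (Sym2 V) :=
  {e ∈ innerPairs A | G.Adj e.1 e.2 ∧ G ∉ dropEvent A B e.1 e.2}.image fun e => s(e.1, e.2)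

/-- Only an upper bound on the number of kept edges is needed, so injectivity of the image map plays
no role. -/
theorem card_keptEdges_add_le (A B : Finset V) (G : SimpleGraph V) :
    (keptEdges A B G).card + dropCount A B G ≤ edgeCount A G := by
  classical
  refine (Nat.add_le_add_right Finset.card_image_le _).trans ?_
  rw [dropCount, eventCount, ← Finset.card_union_of_disjoint]
  · refine Finset.card_le_card fun e he => ?_
    simp only [Finset.mem_union, Finset.mem_filter, Set.mem_ofPred_eq] at he ⊢
    rcases he with he | he
    · exact ⟨he.1, he.2.1⟩
    · exact ⟨he.1, he.2.1⟩
  · rw [Finset.disjoint_filter]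
    exact fun e _ h => h.2

theorem mem_keptEdges {A B : Finset V} {G : SimpleGraph V} {u v : V} (hu : u ∈ A) (hv : v ∈ A)
    (h : G.Adj u v) (hd : G ∉ dropEvent A B u v) : s(u, v) ∈ keptEdges A B G := by
  classical
  rw [keptEdges, Finset.mem_image]
  rcases lt_or_gt_of_ne h.ne with hlt | hlt
  · exact ⟨(u, v), by simp [mem_innerPairs, *], rfl⟩
  · refine ⟨(v, u), ?_, Sym2.eq_swap⟩
    simp only [Finset.mem_filter, mem_innerPairs]
    exact ⟨⟨⟨hv, hu⟩, hlt⟩, h.symm, fun h' => hd (dropEvent_symm h')⟩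

theorem keptEdges_subset (A B : Finset V) (G : SimpleGraph V) :
    (keptEdges A B G : Set (Sym2 V)) ⊆ G.edgeSet := by
  classical
  intro e he
  simp only [keptEdges, Finset.coe_image, Set.mem_image, Finset.mem_coe, Finset.mem_filter] at he
  obtain ⟨x, hx, rfl⟩ := he
  exact hx.2.1

theorem mem_keptEdges_of_crossing {A B : Finset V} {G : SimpleGraph V} {u v b : V}
    (hu : u ∈ A) (hv : v ∈ A) (hb : b ∈ B) (huv : G.Adj u v) (hub : G.Adj u b) (hvb : G.Adj v b) :
    s(u, v) ∈ keptEdges A B G :=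
  mem_keptEdges hu hv huv fun h => h.2.1 b hb ⟨hub, hvb⟩

/-- If all three edges were dropped, then w would witness that uv should have been kept. -/
theorem mem_keptEdges_of_inner {A B : Finset V} {G : SimpleGraph V} {u v w : V}
    (hu : u ∈ A) (hv : v ∈ A) (hw : w ∈ A) (huv : G.Adj u v) (huw : G.Adj u w) (hvw : G.Adj v w) :
    s(u, v) ∈ keptEdges A B G ∨ s(u, w) ∈ keptEdges A B G ∨ s(v, w) ∈ keptEdges A B G := by
  by_contra! h
  have key : ∀ {a b : V}, a ∈ A → b ∈ A → G.Adj a b → s(a, b) ∉ keptEdges A B G →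
      G ∈ dropEvent A B a b := fun ha hb hab h => by
    by_contra hd
    exact h (mem_keptEdges ha hb hab hd)
  exact (key hu hv huv h.1).2.2 w hw ⟨huw, hvw, (key hu hw huw h.2.1).2.1,
    (key hv hw hvw h.2.2).2.1⟩

/-- Two vertices of a triangle share a part. The third is either a common neighbour across, which
keeps their edge, or lies in the same part. -/
theorem isCover_keptEdges_union {A B : Finset V} (hAB : ∀ v, v ∈ A ∨ v ∈ B) (G : SimpleGraph V) :
    IsCover G (keptEdges A B G ∪ keptEdges B A G) := by
  refine ⟨by simpa using ⟨keptEdges_subset A B G, keptEdges_subset B A G⟩, fun T hT => ?_⟩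
  obtain ⟨u, v, w, huv, huw, hvw, rfl⟩ := SimpleGraph.is3Clique_iff.1 hT
  have huvT : s(u, v) ∈ ({u, v, w} : Finset V).sym2 := by simp
  have huwT : s(u, w) ∈ ({u, v, w} : Finset V).sym2 := by simp
  have hvwT : s(v, w) ∈ ({u, v, w} : Finset V).sym2 := by simp
  have inner : ∀ A B : Finset V, u ∈ A → v ∈ A → w ∈ A →
      ∃ e ∈ keptEdges A B G, e ∈ ({u, v, w} : Finset V).sym2 := fun A B hu hv hw => by
    rcases mem_keptEdges_of_inner (B := B) hu hv hw huv huw hvw with h | h | h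
    exacts [⟨_, h, huvT⟩, ⟨_, h, huwT⟩, ⟨_, h, hvwT⟩]
  suffices ∃ e, (e ∈ keptEdges A B G ∨ e ∈ keptEdges B A G) ∧ e ∈ ({u, v, w} : Finset V).sym2 by
    simpa [Finset.mem_union] using this
  rcases hAB u with hu | hu <;> rcases hAB v with hv | hv <;> rcases hAB w with hw | hw
  · obtain ⟨e, h, h'⟩ := inner A B hu hv hw
    exact ⟨e, Or.inl h, h'⟩
  · exact ⟨_, Or.inl (mem_keptEdges_of_crossing hu hv hw huv huw hvw), huvT⟩
  · exact ⟨_, Or.inl (mem_keptEdges_of_crossing hu hw hv huw huv hvw.symm), huwT⟩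
  · exact ⟨_, Or.inr (mem_keptEdges_of_crossing hv hw hu hvw huv.symm huw.symm), hvwT⟩
  · exact ⟨_, Or.inl (mem_keptEdges_of_crossing hv hw hu hvw huv.symm huw.symm), hvwT⟩
  · exact ⟨_, Or.inr (mem_keptEdges_of_crossing hu hw hv huw huv hvw.symm), huwT⟩
  · exact ⟨_, Or.inr (mem_keptEdges_of_crossing hu hv hw huv huw hvw), huvT⟩
  · obtain ⟨e, h, h'⟩ := inner B A hu hv hw
    exact ⟨e, Or.inr h, h'⟩

theorem tau_add_dropCount_le [Finite V] {A B : Finset V} (hAB : ∀ v, v ∈ A ∨ v ∈ B)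
    (G : SimpleGraph V) :
    tau G + (dropCount A B G + dropCount B A G) ≤ edgeCount A G + edgeCount B G := by
  have h1 : tau G ≤ (keptEdges A B G ∪ keptEdges B A G).card :=
    Nat.sInf_le ⟨_, isCover_keptEdges_union hAB G, rfl⟩
  have h2 := Finset.card_union_le (keptEdges A B G) (keptEdges B A G)
  have h3 := card_keptEdges_add_le A B G
  have h4 := card_keptEdges_add_le B A G
  omega

end

/-! ### Concentration of the edge and drop counts -/

section Concentration

variable {V : Type*} [Fintype V] [LinearOrder V] (p : I)

theorem measureReal_adj_inter {e f : V × V} (he : e.1 < e.2) (hf : f.1 < f.2) (hef : e ≠ f) :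
    (SimpleGraph.binomialRandom V p).real ({G | G.Adj e.1 e.2} ∩ {G | G.Adj f.1 f.2}) =
      (p : ℝ) ^ 2 := by
  have h1 : EdgeDetermined {s(e.1, e.2)} {G : SimpleGraph V | G.Adj e.1 e.2} :=
    edgeDetermined_adj e.1 e.2 id
  have h2 : EdgeDetermined {s(f.1, f.2)} {G : SimpleGraph V | G.Adj f.1 f.2} :=
    edgeDetermined_adj f.1 f.2 id
  rw [measureReal_inter_of_disjoint p h1 h2, measureReal_adj p he.ne, measureReal_adj p hf.ne, sq]
  rw [Set.disjoint_singleton, ne_eq, Sym2.eq_iff, not_or]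
  refine ⟨fun h => hef (Prod.ext h.1 h.2), fun h => ?_⟩
  rw [h.1, h.2] at he
  exact lt_asymm he hf

theorem measureReal_edgeCount_ge_le (A : Finset V) {t : ℝ} (ht : 0 < t) :
    (SimpleGraph.binomialRandom V p).real
        {G | (innerPairs A).card * (p : ℝ) + t ≤ edgeCount A G} ≤
      (innerPairs A).card * p / t ^ 2 := by
  have hp0 : (0 : ℝ) ≤ p := p.2.1
  set E : V × V → Set (SimpleGraph V) := fun e => {G | G.Adj e.1 e.2} with hE
  have hm : ∀ e ∈ innerPairs A, (SimpleGraph.binomialRandom V p).real (E e) = p := fun e he =>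
    measureReal_adj p (mem_innerPairs.1 he).2.ne
  have h1 := measureReal_le_abs_eventCount_sub (SimpleGraph.binomialRandom V p) (innerPairs A) E ht
  rw [Finset.sum_congr rfl hm, Finset.sum_const, nsmul_eq_mul] at h1
  have h2 : ∑ e ∈ innerPairs A, ∑ f ∈ innerPairs A,
      (SimpleGraph.binomialRandom V p).real (E e ∩ E f) ≤
      ∑ e ∈ innerPairs A, ∑ f ∈ innerPairs A, ((if e = f then (p : ℝ) else 0) + (p : ℝ) ^ 2) := by
    refine Finset.sum_le_sum fun e he => Finset.sum_le_sum fun f hf => ?_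
    split_ifs with hef
    · subst hef
      rw [Set.inter_self, hm e he]
      nlinarith
    · rw [measureReal_adj_inter p (mem_innerPairs.1 he).2 (mem_innerPairs.1 hf).2 hef, zero_add]
  have h3 : ∑ e ∈ innerPairs A, ∑ f ∈ innerPairs A,
      ((if e = f then (p : ℝ) else 0) + (p : ℝ) ^ 2) =
      (innerPairs A).card * p + ((innerPairs A).card * (p : ℝ)) ^ 2 := by
    simp only [Finset.sum_add_distrib, Finset.sum_ite_eq, Finset.sum_const, nsmul_eq_mul,
      Finset.sum_ite_mem, Finset.inter_self]
    ring
  refine (measureReal_mono ?_).trans (h1.trans ?_)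
  · intro G hG
    change t ≤ |(eventCount (innerPairs A) E G : ℝ) - _|
    refine le_trans ?_ (le_abs_self _)
    have : (innerPairs A).card * (p : ℝ) + t ≤ eventCount (innerPairs A) E G := hG
    linarith
  · gcongr
    linarith

/-- The three terms come from pairs of edges that are equal, share an endpoint, or are disjoint. In
the last case the joint bound and the squared single bound contain the same `dropSum`², and only e^η
- e^{-2η} remains. -/
theorem measureReal_dropCount_le_le {A B : Finset V} (hAB : Disjoint A B) (hp : (p : ℝ) ≤ 1 / 2)
    {t : ℝ} (ht : 0 < t) :
    (SimpleGraph.binomialRandom V p).real {G | (dropCount A B G : ℝ) ≤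
        (innerPairs A).card * (p * (Real.exp (-dropError A.card p) * dropSum A.card p B)) - t} ≤
      ((innerPairs A).card * p + 4 * Fintype.card V * (innerPairs A).card * (p : ℝ) ^ 2 +
        ((innerPairs A).card * (p : ℝ)) ^ 2 *
          (Real.exp (dropError A.card p) - Real.exp (-dropError A.card p) ^ 2)) / t ^ 2 := by
  have hp0 : (0 : ℝ) ≤ p := p.2.1
  set η := dropError A.card p with hη
  set h := dropSum A.card p B with hh
  have hh0 : 0 ≤ h := dropSum_nonneg B hp0 p.2.2
  have hh1 : h ≤ 1 := dropSum_le_one B (Nat.cast_nonneg _) hp0 p.2.2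
  have hη0 : 0 ≤ η := by
    rw [hη, dropError]
    positivity
  set M : ℝ := ((innerPairs A).card : ℝ) with hM
  have hM0 : 0 ≤ M := Nat.cast_nonneg _
  set E : V × V → Set (SimpleGraph V) := fun e => dropEvent A B e.1 e.2 with hE
  have hm : M * (p * (Real.exp (-η) * h)) ≤
      ∑ e ∈ innerPairs A, (SimpleGraph.binomialRandom V p).real (E e) := by
    rw [hM, ← nsmul_eq_mul]
    refine Finset.card_nsmul_le_sum _ _ _ fun e he => ?_
    obtain ⟨⟨h1, h2⟩, h3⟩ := mem_innerPairs.1 he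
    exact measureReal_dropEvent_ge_dropSum p hAB h1 h2 h3.ne hp
  have h1 := measureReal_le_abs_eventCount_sub (SimpleGraph.binomialRandom V p) (innerPairs A) E ht
  -- The ordered pairs meeting `e`, covered by four lines of |V| pairs each.
  let share : V × V → Finset (V × V) := fun e =>
    (({e.1} ×ˢ Finset.univ) ∪ ({e.2} ×ˢ Finset.univ)) ∪
      ((Finset.univ ×ˢ {e.1}) ∪ (Finset.univ ×ˢ {e.2}))
  have hshare : ∀ e, ((share e).card : ℝ) ≤ 4 * Fintype.card V := by
    intro e
    have : (share e).card ≤ 4 * Fintype.card V := by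
      refine (Finset.card_union_le _ _).trans ((Nat.add_le_add (Finset.card_union_le _ _)
        (Finset.card_union_le _ _)).trans ?_)
      simp only [Finset.card_product, Finset.card_singleton, Finset.card_univ]
      omega
    exact_mod_cast this
  have hsub : ∀ e : V × V, E e ⊆ {G | G.Adj e.1 e.2} := fun e G hG => hG.1
  have hpair : ∀ e ∈ innerPairs A, ∀ f ∈ innerPairs A,
      (SimpleGraph.binomialRandom V p).real (E e ∩ E f) ≤
        (if e = f then (p : ℝ) else 0) + (if f ∈ share e then (p : ℝ) ^ 2 else 0) +
          (p : ℝ) ^ 2 * (Real.exp η * h ^ 2) := by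
    intro e he f hf
    have hlast : 0 ≤ (p : ℝ) ^ 2 * (Real.exp η * h ^ 2) := by positivity
    have hmid : 0 ≤ (if f ∈ share e then (p : ℝ) ^ 2 else 0) := by positivity
    obtain ⟨⟨e1, e2⟩, e3⟩ := mem_innerPairs.1 he
    obtain ⟨⟨f1, f2⟩, f3⟩ := mem_innerPairs.1 hf
    by_cases hef : e = f
    · have h2 : (SimpleGraph.binomialRandom V p).real (E e ∩ E f) ≤ p := by
        rw [← measureReal_adj p e3.ne]
        exact measureReal_mono (Set.inter_subset_left.trans (hsub e))
      rw [if_pos hef]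
      linarith
    rw [if_neg hef, zero_add]
    by_cases hs : f ∈ share e
    · have h2 : (SimpleGraph.binomialRandom V p).real (E e ∩ E f) ≤ (p : ℝ) ^ 2 := by
        rw [← measureReal_adj_inter p e3 f3 hef]
        exact measureReal_mono (Set.inter_subset_inter (hsub e) (hsub f))
      rw [if_pos hs]
      linarith
    · rw [if_neg hs, zero_add]
      simp only [share, Finset.mem_union, Finset.mem_product, Finset.mem_singleton,
        Finset.mem_univ, and_true, true_and, not_or] at hs
      exact measureReal_dropEvent_inter_le_dropSum p hAB e1 e2 f1 f2 e3.ne f3.ne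
        (Ne.symm hs.1.1) (Ne.symm hs.2.1) (Ne.symm hs.1.2) (Ne.symm hs.2.2)
  have h2 : ∑ e ∈ innerPairs A, ∑ f ∈ innerPairs A,
      (SimpleGraph.binomialRandom V p).real (E e ∩ E f) ≤
        M * p + 4 * Fintype.card V * M * (p : ℝ) ^ 2 + (M * p) ^ 2 * (Real.exp η * h ^ 2) := by
    calc _ ≤ ∑ e ∈ innerPairs A, ((p : ℝ) + 4 * (Fintype.card V : ℝ) * (p : ℝ) ^ 2 +
          M * ((p : ℝ) ^ 2 * (Real.exp η * h ^ 2))) := by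
          refine Finset.sum_le_sum fun e he => (Finset.sum_le_sum (hpair e he)).trans ?_
          rw [Finset.sum_add_distrib, Finset.sum_add_distrib, Finset.sum_ite_eq, if_pos he,
            Finset.sum_const, nsmul_eq_mul, Finset.sum_ite_mem, Finset.sum_const, nsmul_eq_mul]
          have : ((innerPairs A ∩ share e).card : ℝ) ≤ (share e).card := by
            exact_mod_cast Finset.card_le_card Finset.inter_subset_right
          have := mul_le_mul_of_nonneg_right (this.trans (hshare e)) (sq_nonneg (p : ℝ))
          linarith
      _ = _ := by
          rw [Finset.sum_const, nsmul_eq_mul]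
          ring
  refine (measureReal_mono ?_).trans (h1.trans ?_)
  · intro G hG
    change t ≤ |(eventCount (innerPairs A) E G : ℝ) - _|
    refine le_trans ?_ (neg_le_abs _)
    have : (eventCount (innerPairs A) E G : ℝ) ≤ M * (p * (Real.exp (-η) * h)) - t := hG
    linarith
  · gcongr
    have h3 : (M * (p * (Real.exp (-η) * h))) ^ 2 ≤
        (∑ e ∈ innerPairs A, (SimpleGraph.binomialRandom V p).real (E e)) ^ 2 := by
      gcongr
    have h4 : (M * (p : ℝ)) ^ 2 * (Real.exp η * h ^ 2) - (M * (p * (Real.exp (-η) * h))) ^ 2 ≤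
        (M * (p : ℝ)) ^ 2 * (Real.exp η - Real.exp (-η) ^ 2) := by
      have h5 : 0 ≤ Real.exp η - Real.exp (-η) ^ 2 := by
        have h6 : 1 ≤ Real.exp η := Real.one_le_exp hη0
        have h7 : Real.exp (-η) ≤ 1 := Real.exp_le_one_iff.2 (by linarith)
        nlinarith [Real.exp_pos (-η)]
      have h8 : h ^ 2 ≤ 1 := pow_le_one₀ hh0 hh1
      have h9 : 0 ≤ (M * (p : ℝ)) ^ 2 * (Real.exp η - Real.exp (-η) ^ 2) := by positivity
      nlinarith
    linarith

end Concentration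

/-- Diagonal choice: ε_n lies just above the infimum of the δ > 0 with f_n(δ) ≥ 1-δ. Every fixed
positive δ is eventually admissible, so the infimum tends to 0. -/
theorem exists_tendsto_zero_tendsto_one {f : ℕ → ℝ → ℝ} (hmono : ∀ᶠ n in atTop, Monotone (f n))
    (h0 : ∀ n ε, 0 ≤ f n ε) (h1 : ∀ n ε, f n ε ≤ 1)
    (h : ∀ ε > 0, Tendsto (fun n => f n ε) atTop (𝓝 1)) :
    ∃ ε : ℕ → ℝ, Tendsto ε atTop (𝓝 0) ∧ Tendsto (fun n => f n (ε n)) atTop (𝓝 1) := by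
  let S : ℕ → Set ℝ := fun n => {δ | 0 < δ ∧ 1 - δ ≤ f n δ}
  have hbdd : ∀ n, BddBelow (S n) := fun n => ⟨0, fun δ hδ => hδ.1.le⟩
  have hne : ∀ n, (S n).Nonempty := fun n => ⟨1, one_pos, by simpa using h0 n 1⟩
  have hnonneg : ∀ n, 0 ≤ sInf (S n) := fun n => Real.sInf_nonneg fun δ hδ => hδ.1.le
  have hlim : Tendsto (fun n => sInf (S n)) atTop (𝓝 0) := by
    refine (tendsto_order.2 ⟨fun a ha => .of_forall fun n => ha.trans_le (hnonneg n),
      fun a ha => ?_⟩)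
    filter_upwards [(tendsto_order.1 (h (a / 2) (by positivity))).1 (1 - a / 2) (by linarith)]
      with n hn
    have : sInf (S n) ≤ a / 2 := csInf_le (hbdd n) ⟨by positivity, hn.le⟩
    linarith
  -- The term 1/(n+1) puts ε_n strictly above the infimum, so that some admissible δ lies below it
  -- and monotonicity applies.
  let ε : ℕ → ℝ := fun n => sInf (S n) + 1 / ((n : ℝ) + 1)
  have hε : Tendsto ε atTop (𝓝 0) := by
    simpa [ε] using hlim.add tendsto_one_div_add_atTop_nhds_zero_nat
  refine ⟨ε, hε, ?_⟩
  have hlow : Tendsto (fun n => 1 - ε n) atTop (𝓝 1) := by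
    simpa using hε.const_sub 1
  refine tendsto_of_tendsto_of_tendsto_of_le_of_le' hlow tendsto_const_nhds ?_
    (.of_forall fun n => h1 n _)
  filter_upwards [hmono] with n hn
  obtain ⟨δ, hδ, hlt⟩ := exists_lt_of_csInf_lt (hne n)
    (show sInf (S n) < ε n from lt_add_of_pos_right _ (by positivity))
  have := hn hlt.le
  have := hδ.2
  linarith

/-! ### Comparison with exp(-(d/2)(1+e^{-d})) -/

/-- A constant bounding the relative error in the probability that an edge is dropped. -/
def errorConst (c : ℝ) : ℝ := 17 + 4 * c + c ^ 2

section Bounds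

variable {n c x d α : ℝ}

theorem dropError_le (hx0 : 0 ≤ x) (hx1 : x ≤ 1 / 2) (hd : d = (n - 2) * x ^ 2)
    (hc : 0 ≤ c) (hdc : d ≤ c) (hα : α ≤ (n + 1) / 2) : dropError α x ≤ (11 + c) * x := by
  have h1 : 2 * α * x ^ 4 ≤ x ^ 2 * (d + 3 * x ^ 2) := by
    have : 2 * α * x ^ 4 ≤ (n + 1) * x ^ 4 := by
      gcongr
      linarith
    rw [hd]
    linarith
  have h2 : x ^ 2 ≤ x := by nlinarith
  have h3 : x ^ 2 * (d + 3 * x ^ 2) ≤ x ^ 2 * (c + 3) := by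
    gcongr
    nlinarith
  rw [dropError]
  have := mul_le_mul_of_nonneg_right h2 (by linarith : 0 ≤ c + 3)
  linarith

/-- Parts of size about n/2 are inserted into `le_dropSum`. Since (n+1)x² = d + 3x², both |B|x² and
αx² are at most d/2 + (3/2)x², and the mean in Jensen's bound is at most e^{-d} + dx. -/
theorem le_exp_neg_dropError_mul_dropSum {V : Type*} [DecidableEq V] {B : Finset V} (hn : 2 ≤ n)
    (hx0 : 0 ≤ x) (hx1 : x ≤ 1 / 2) (hd : d = (n - 2) * x ^ 2) (hdc : d ≤ c)
    (hα0 : 0 ≤ α) (hα : α ≤ (n + 1) / 2) (hB : (B.card : ℝ) ≤ (n + 1) / 2)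
    (hB' : (n - 2) / 2 ≤ B.card) :
    Real.exp (-(d / 2) * (1 + Real.exp (-d))) - errorConst c * x ≤
      Real.exp (-dropError α x) * dropSum α x B := by
  have hd0 : 0 ≤ d := by
    rw [hd]
    have : 0 ≤ n - 2 := by linarith
    positivity
  have hη := dropError_le hx0 hx1 hd (hd0.trans hdc) hdc hα
  have hx2 : x ^ 2 ≤ x := by nlinarith
  have hx4 : x ^ 4 ≤ x ^ 2 := by nlinarith [sq_nonneg x]
  set β : ℝ := (B.card : ℝ) with hβ
  have hβ0 : 0 ≤ β := Nat.cast_nonneg _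
  have hpow1 : Real.exp (-(β * (x ^ 2 + 2 * x ^ 4))) ≤ (1 - x ^ 2) ^ B.card := by
    have h1 := exp_neg_le_one_sub (t := x ^ 2) (by linarith)
    calc Real.exp (-(β * (x ^ 2 + 2 * x ^ 4)))
        = Real.exp (-(x ^ 2 + 2 * (x ^ 2) ^ 2)) ^ B.card := by
          rw [← Real.exp_nat_mul]
          congr 1
          rw [hβ]
          ring
      _ ≤ _ := pow_le_pow_left₀ (Real.exp_pos _).le h1 _
  have hdiv : x ^ 2 * (1 - x) ≤ x ^ 2 / (1 + x) := by
    rw [le_div_iff₀ (by linarith)]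
    nlinarith [mul_nonneg (sq_nonneg x) (sq_nonneg x)]
  have hpow2 : (1 - 2 * x ^ 2 / (1 + x)) ^ B.card ≤ Real.exp (-d) + d * x := by
    have h0 : 0 ≤ 1 - 2 * x ^ 2 / (1 + x) := by
      rw [sub_nonneg, div_le_one (by linarith)]
      nlinarith
    have h1 : 1 - 2 * x ^ 2 / (1 + x) ≤ Real.exp (-(2 * (x ^ 2 * (1 - x)))) := by
      have := Real.add_one_le_exp (-(2 * (x ^ 2 * (1 - x))))
      have h2 : 2 * x ^ 2 / (1 + x) = 2 * (x ^ 2 / (1 + x)) := by ring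
      linarith
    calc (1 - 2 * x ^ 2 / (1 + x)) ^ B.card
        ≤ Real.exp (-(2 * (x ^ 2 * (1 - x)))) ^ B.card := pow_le_pow_left₀ h0 h1 _
      _ = Real.exp (-(2 * β * (x ^ 2 * (1 - x)))) := by
          rw [← Real.exp_nat_mul]
          congr 1
          rw [hβ]
          ring
      _ ≤ Real.exp (-(d * (1 - x))) := by
          rw [Real.exp_le_exp, hd, neg_le_neg_iff, mul_assoc (n - 2)]
          have : 0 ≤ x ^ 2 * (1 - x) := mul_nonneg (sq_nonneg x) (by linarith)
          nlinarith
      _ ≤ Real.exp (-d) + d * x := by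
          have h3 := Real.add_one_le_exp (-(d * x))
          have h4 : Real.exp (-(d * (1 - x))) ≤ 1 := by
            rw [Real.exp_le_one_iff, neg_nonpos]
            exact mul_nonneg hd0 (by linarith)
          have h5 : Real.exp (-d) = Real.exp (-(d * (1 - x))) * Real.exp (-(d * x)) := by
            rw [← Real.exp_add]
            congr 1
            ring
          have h6 : 0 ≤ d * x := by positivity
          nlinarith [Real.exp_pos (-(d * (1 - x)))]
  have hexp1 : Real.exp (-d) ≤ 1 := Real.exp_le_one_iff.2 (by linarith)
  have hβx : β * x ^ 2 ≤ d / 2 + 3 / 2 * x ^ 2 := by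
    have := mul_le_mul_of_nonneg_right hB (sq_nonneg x)
    rw [hd]
    linarith
  have hαx : α * x ^ 2 ≤ d / 2 + 3 / 2 * x ^ 2 := by
    have := mul_le_mul_of_nonneg_right hα (sq_nonneg x)
    rw [hd]
    linarith
  have hβx4 : β * (2 * x ^ 4) ≤ (c + 3) * x := by
    have h1 := mul_le_mul_of_nonneg_right hβx (sq_nonneg x)
    nlinarith
  have hαq : α * (x ^ 2 * (1 - 2 * x ^ 2 / (1 + x)) ^ B.card) ≤
      d / 2 * Real.exp (-d) + (c ^ 2 / 2 + 3 / 2 + 3 / 2 * c) * x := by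
    calc α * (x ^ 2 * (1 - 2 * x ^ 2 / (1 + x)) ^ B.card)
        ≤ α * (x ^ 2 * (Real.exp (-d) + d * x)) := by gcongr
      _ = α * x ^ 2 * (Real.exp (-d) + d * x) := by ring
      _ ≤ (d / 2 + 3 / 2 * x ^ 2) * (Real.exp (-d) + d * x) := by
          gcongr
      _ = d / 2 * Real.exp (-d) + (d ^ 2 / 2 * x + 3 / 2 * x ^ 2 * Real.exp (-d) +
            3 / 2 * x ^ 2 * (d * x)) := by ring
      _ ≤ d / 2 * Real.exp (-d) + (c ^ 2 / 2 * x + 3 / 2 * x * 1 + 3 / 2 * x * (c * 1)) := by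
          have hx1' : x ≤ 1 := by linarith
          have hc0 : 0 ≤ c := hd0.trans hdc
          gcongr
      _ = _ := by ring
  have hmain : Real.exp (-(d / 2) * (1 + Real.exp (-d)) - errorConst c * x) ≤
      Real.exp (-dropError α x) * dropSum α x B := by
    calc Real.exp (-(d / 2) * (1 + Real.exp (-d)) - errorConst c * x)
        ≤ Real.exp (-dropError α x + (-(β * (x ^ 2 + 2 * x ^ 4)) +
            -(α * (x ^ 2 * (1 - 2 * x ^ 2 / (1 + x)) ^ B.card)))) := by
          -- The constants add up to 11 + 3 + 3/2 + 3/2 = 17; the coefficients of c and c² are 7/2 ≤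
          -- 4 and 1/2 ≤ 1.
          rw [Real.exp_le_exp, errorConst]
          have : 0 ≤ c * x := mul_nonneg (hd0.trans hdc) hx0
          have : 0 ≤ c ^ 2 * x := by positivity
          linarith
      _ = Real.exp (-dropError α x) * (Real.exp (-(β * (x ^ 2 + 2 * x ^ 4))) *
            Real.exp (-(α * (x ^ 2 * (1 - 2 * x ^ 2 / (1 + x)) ^ B.card)))) := by
          rw [Real.exp_add, Real.exp_add]
      _ ≤ _ := by
          refine mul_le_mul_of_nonneg_left ?_ (Real.exp_pos _).le
          refine le_trans ?_ (le_dropSum α B hx0 (by linarith))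
          gcongr
  refine le_trans ?_ hmain
  set y := -(d / 2) * (1 + Real.exp (-d)) with hy
  have hy1 : Real.exp y ≤ 1 := by
    rw [Real.exp_le_one_iff, hy]
    have := Real.exp_pos (-d)
    nlinarith
  have hc0 : 0 ≤ errorConst c * x := by
    have : 0 ≤ c := hd0.trans hdc
    rw [errorConst]
    positivity
  rw [sub_eq_add_neg y, Real.exp_add]
  -- With z the error term, e^{y-z} ≥ e^y(1-z) ≥ e^y - z, because e^y ≤ 1.
  have h1 := Real.add_one_le_exp (-(errorConst c * x))
  nlinarith [Real.exp_pos y]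

end Bounds

/-! ### The two halves of the vertex set -/

section Parts

/-- Equality holds in the extreme case |A| = (n+1)/2, where |A|(|A|-1)/2 = (n²-1)/8. -/
theorem card_innerPairs_le {n : ℕ} (hn : 3 ≤ n) {A : Finset (Fin n)}
    (hA : (A.card : ℝ) ≤ (n + 1) / 2) {x : ℝ} (hx : 0 ≤ x) :
    (innerPairs A).card * x ≤ (n.choose 2 : ℝ) * x / 4 * (1 + 1 / n) := by
  have hn' : (3 : ℝ) ≤ n := by exact_mod_cast hn
  rw [card_innerPairs, Nat.cast_choose_two]
  have h1 : (A.card : ℝ) * (A.card - 1) / 2 ≤ (n * (n - 1) / 2) / 4 * (1 + 1 / n) := by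
    have h2 : ((n : ℝ) * (n - 1) / 2) / 4 * (1 + 1 / n) = (n + 1) / 2 * ((n + 1) / 2 - 1) / 2 := by
      field_simp
      ring
    rw [h2]
    have h3 : (0 : ℝ) ≤ A.card := Nat.cast_nonneg _
    nlinarith
  calc _ ≤ (n * (n - 1) / 2) / 4 * (1 + 1 / n) * x := mul_le_mul_of_nonneg_right h1 hx
    _ = _ := by ring

variable {n : ℕ} (p : I) {c δ : ℝ} {A B : Finset (Fin n)}

theorem measureReal_edgeCount_ge_meanEdges_le (hn : 3 ≤ n) (hA : (A.card : ℝ) ≤ (n + 1) / 2)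
    (hδ : 0 < δ) (hm : 0 < meanEdges n p) :
    (SimpleGraph.binomialRandom (Fin n) p).real
        {G | (innerPairs A).card * (p : ℝ) + δ * meanEdges n p ≤ edgeCount A G} ≤
      (1 / meanEdges n p) / δ ^ 2 := by
  refine (measureReal_edgeCount_ge_le p A (mul_pos hδ hm)).trans ?_
  have hn' : (3 : ℝ) ≤ n := by exact_mod_cast hn
  have h1 := card_innerPairs_le hn hA p.2.1
  rw [← meanEdges] at h1
  have h2 : (1 : ℝ) / n ≤ 1 := by
    rw [div_le_one (by linarith)]
    linarith
  have h3 : (innerPairs A).card * (p : ℝ) ≤ meanEdges n p := by nlinarith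
  calc _ ≤ meanEdges n p / (δ * meanEdges n p) ^ 2 := by gcongr
    _ = _ := by
      field_simp

theorem measureReal_dropCount_le_meanEdges_le (hn : 3 ≤ n) (hAB : Disjoint A B)
    (hp : (p : ℝ) ≤ 1 / 2) (hdc : meanCodegree n p ≤ c) (hA : (A.card : ℝ) ≤ (n + 1) / 2)
    (hB : (B.card : ℝ) ≤ (n + 1) / 2) (hB' : ((n : ℝ) - 2) / 2 ≤ B.card)
    (hδ : 0 < δ) (hm : 0 < meanEdges n p) :
    (SimpleGraph.binomialRandom (Fin n) p).real
        {G | (dropCount A B G : ℝ) ≤ (innerPairs A).card * (p * (Real.exp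
          (-(meanCodegree n p / 2) * (1 + Real.exp (-meanCodegree n p))) - errorConst c * p)) -
            δ * meanEdges n p} ≤
      (1 / meanEdges n p + 8 / (n - 1) +
        (Real.exp ((11 + c) * p) - Real.exp (-((11 + c) * p)) ^ 2)) / δ ^ 2 := by
  have hn' : (3 : ℝ) ≤ n := by exact_mod_cast hn
  have hp0 : (0 : ℝ) ≤ p := p.2.1
  have hd0 : 0 ≤ meanCodegree n p := by
    rw [meanCodegree]
    have : 0 ≤ (n : ℝ) - 2 := by linarith
    positivity
  have hη := dropError_le (α := A.card) hp0 hp rfl (hd0.trans hdc) hdc hA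
  have hlow := le_exp_neg_dropError_mul_dropSum (α := A.card) (B := B) (by linarith) hp0 hp rfl hdc
    (Nat.cast_nonneg _) hA hB hB'
  rw [← meanCodegree] at hlow
  have h1 := card_innerPairs_le hn hA p.2.1
  rw [← meanEdges] at h1
  have h2 : (1 : ℝ) / n ≤ 1 := by
    rw [div_le_one (by linarith)]
    linarith
  have h3 : (innerPairs A).card * (p : ℝ) ≤ meanEdges n p := by nlinarith
  refine (measureReal_mono (s₂ := {G | (dropCount A B G : ℝ) ≤ (innerPairs A).card *
    (p * (Real.exp (-dropError A.card p) * dropSum A.card p B)) - δ * meanEdges n p}) ?_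
    (measure_ne_top _ _)).trans
    ((measureReal_dropCount_le_le p hAB hp (mul_pos hδ hm)).trans ?_)
  · intro G hG
    refine le_trans (Set.mem_ofPred_eq ▸ hG) ?_
    gcongr
  · rw [Fintype.card_fin]
    set m := meanEdges n p with hm'
    -- This makes the contribution of edges sharing an endpoint O(m²/n).
    have hpm : 4 * n * (p : ℝ) = 8 / (n - 1) * m := by
      have : (n : ℝ) - 1 ≠ 0 := by linarith
      rw [hm', meanEdges, Nat.cast_choose_two]
      field_simp
      ring
    have h5 : 0 ≤ Real.exp ((11 + c) * p) - Real.exp (-((11 + c) * p)) ^ 2 := by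
      have h0 : 0 ≤ (11 + c) * p := by
        refine le_trans ?_ hη
        rw [dropError]
        positivity
      have h6 : 1 ≤ Real.exp ((11 + c) * p) := Real.one_le_exp h0
      have h7 : Real.exp (-((11 + c) * p)) ≤ 1 := Real.exp_le_one_iff.2 (by linarith)
      nlinarith [Real.exp_pos (-((11 + c) * p))]
    have h6 : 4 * n * (innerPairs A).card * (p : ℝ) ^ 2 ≤ 8 / (n - 1) * m ^ 2 := by
      calc 4 * n * (innerPairs A).card * (p : ℝ) ^ 2
          = (4 * n * (p : ℝ)) * ((innerPairs A).card * p) := by ring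
        _ ≤ (4 * n * (p : ℝ)) * m := by gcongr
        _ = _ := by
          rw [hpm]
          ring
    have h7 : ((innerPairs A).card * (p : ℝ)) ^ 2 *
        (Real.exp (dropError A.card p) - Real.exp (-dropError A.card p) ^ 2) ≤
        m ^ 2 * (Real.exp ((11 + c) * p) - Real.exp (-((11 + c) * p)) ^ 2) := by
      calc _ ≤ ((innerPairs A).card * (p : ℝ)) ^ 2 *
            (Real.exp ((11 + c) * p) - Real.exp (-((11 + c) * p)) ^ 2) := by gcongr
        _ ≤ _ := by gcongr
    calc _ ≤ (m + 8 / (n - 1) * m ^ 2 + m ^ 2 *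
          (Real.exp ((11 + c) * p) - Real.exp (-((11 + c) * p)) ^ 2)) / (δ * m) ^ 2 := by
          gcongr
      _ = _ := by
        field_simp

/-- An upper bound for the probability that `τ(G)` is large. -/
noncomputable def failBound (n : ℕ) (x c δ : ℝ) : ℝ :=
  2 * ((1 / meanEdges n x) / δ ^ 2 + (1 / meanEdges n x + 8 / (n - 1) +
        (Real.exp ((11 + c) * x) - Real.exp (-((11 + c) * x)) ^ 2)) / δ ^ 2)

/-- There are four exceptional events, an edge count and a drop count for each part, each with slack
δm. Outside them, edges minus drops is at most (m/2)(1+1/n)(1-D+e) + 4δm, whose leading term is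
m(1-D)/2 = ψm. -/
theorem measureReal_lt_tau_le (hn : 3 ≤ n) (hp : (p : ℝ) ≤ 1 / 2) (hdc : meanCodegree n p ≤ c)
    (hδ : 0 < δ) (hm : 0 < meanEdges n p) :
    (SimpleGraph.binomialRandom (Fin n) p).real
        {G | (psi (meanCodegree n p) + 4 * δ +
          (errorConst c * p + (1 + errorConst c * p) / n) / 2) * meanEdges n p < tau G} ≤
      failBound n p c δ := by
  have hn' : (3 : ℝ) ≤ n := by exact_mod_cast hn
  have hp0 : (0 : ℝ) ≤ p := p.2.1
  let A : Finset (Fin n) := {i | i.val < n / 2}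
  have hAc : A.card = n / 2 := by
    simp only [A]
    rw [Fin.card_filter_val_lt]
    omega
  have hBc : Aᶜ.card = n - n / 2 := by
    rw [Finset.card_compl, hAc, Fintype.card_fin]
  have hA1 : (A.card : ℝ) ≤ (n + 1) / 2 := by
    have : 2 * A.card ≤ n + 1 := by omega
    have : (2 : ℝ) * A.card ≤ n + 1 := by exact_mod_cast this
    linarith
  have hB1 : (Aᶜ.card : ℝ) ≤ (n + 1) / 2 := by
    have : 2 * Aᶜ.card ≤ n + 1 := by omega
    have : (2 : ℝ) * Aᶜ.card ≤ n + 1 := by exact_mod_cast this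
    linarith
  have hA2 : ((n : ℝ) - 2) / 2 ≤ A.card := by
    have : n ≤ 2 * A.card + 2 := by omega
    have : (n : ℝ) ≤ 2 * A.card + 2 := by exact_mod_cast this
    linarith
  have hB2 : ((n : ℝ) - 2) / 2 ≤ Aᶜ.card := by
    have : n ≤ 2 * Aᶜ.card + 2 := by omega
    have : (n : ℝ) ≤ 2 * Aᶜ.card + 2 := by exact_mod_cast this
    linarith
  have y1 := measureReal_edgeCount_ge_meanEdges_le p hn hA1 hδ hm
  have y2 := measureReal_edgeCount_ge_meanEdges_le p hn hB1 hδ hm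
  have x1 := measureReal_dropCount_le_meanEdges_le p hn disjoint_compl_right hp hdc hA1 hB1 hB2 hδ
    hm
  have x2 := measureReal_dropCount_le_meanEdges_le p hn disjoint_compl_left hp hdc hB1 hA1 hA2 hδ
    hm
  set d := meanCodegree n p with hd
  set m := meanEdges n p with hm'
  set D := Real.exp (-(d / 2) * (1 + Real.exp (-d))) with hD
  set e := errorConst c * p with he
  have hd0 : 0 ≤ d := by
    rw [hd, meanCodegree]
    have : 0 ≤ (n : ℝ) - 2 := by linarith
    positivity
  have he0 : 0 ≤ e := by
    have : 0 ≤ c := hd0.trans hdc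
    rw [he, errorConst]
    positivity
  have hD1 : D ≤ 1 := by
    rw [hD, Real.exp_le_one_iff]
    have := Real.exp_pos (-d)
    nlinarith
  have hD0 : 0 < D := Real.exp_pos _
  refine (measureReal_mono (s₂ := (_ ∪ _) ∪ (_ ∪ _)) ?_ (measure_ne_top _ _)).trans
    ((measureReal_union_le _ _).trans ((add_le_add ((measureReal_union_le _ _).trans
      (add_le_add y1 y2)) ((measureReal_union_le _ _).trans (add_le_add x1 x2))).trans_eq ?_))
  · intro G hG
    by_contra hcon
    simp only [Set.mem_union, Set.mem_ofPred_eq, not_or, not_le] at hcon hG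
    obtain ⟨⟨a1, a2⟩, b1, b2⟩ := hcon
    have ht := tau_add_dropCount_le (A := A) (B := Aᶜ)
      (fun v => by simpa using em (v ∈ A)) G
    have ht' : (tau G : ℝ) + (dropCount A Aᶜ G + dropCount Aᶜ A G) ≤
        edgeCount A G + edgeCount Aᶜ G := by exact_mod_cast ht
    have c1 := card_innerPairs_le hn hA1 hp0
    have c2 := card_innerPairs_le hn hB1 hp0
    rw [← meanEdges, ← hm'] at c1 c2
    have hfac : 0 ≤ 1 - D + e := by linarith
    -- Edges and drops are combined before the number of inner pairs is replaced by its upper bound,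
    -- as the drop term alone enters with a negative sign.
    have c3 := mul_le_mul_of_nonneg_right (add_le_add c1 c2) hfac
    have hpsi : psi d = (1 - D) / 2 := by
      rw [psi, hD]
      ring
    rw [hpsi] at hG
    have hinv : 0 ≤ 1 / (n : ℝ) := by positivity
    have c4 : (m / 4 * (1 + 1 / n) + m / 4 * (1 + 1 / n)) * (1 - D + e) ≤
        m * ((1 - D) / 2 + (e + (1 + e) / n) / 2) := by
      have : (m / 4 * (1 + 1 / n) + m / 4 * (1 + 1 / n)) * (1 - D + e) =
        m * ((1 - D) / 2 + (e + (1 + e) / n) / 2) - m * D * (1 / n) / 2 := by ring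
      have : 0 ≤ m * D * (1 / n) := by positivity
      linarith
    linarith
  · rw [failBound]
    ring

end Parts

/-! ### Passage to the limit -/

/-- For c > 0 this keeps ψ away from 0, so additive errors o(m) become relative ones. -/
theorem le_psi {c d : ℝ} (hc : 0 ≤ c) (h : c ≤ d) :
    (1 / 2) * (1 - Real.exp (-(c / 2))) ≤ psi d := by
  have h1 : Real.exp (-(d / 2) * (1 + Real.exp (-d))) ≤ Real.exp (-(c / 2)) := by
    rw [Real.exp_le_exp]
    nlinarith [Real.exp_pos (-d)]
  rw [psi]
  linarith

theorem tendsto_failBound {x : ℕ → ℝ} (c δ : ℝ) (hx : Tendsto x atTop (𝓝 0))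
    (hm : Tendsto (fun n => meanEdges n (x n)) atTop atTop) :
    Tendsto (fun n => failBound n (x n) c δ) atTop (𝓝 0) := by
  have h1 : Tendsto (fun n => 1 / meanEdges n (x n)) atTop (𝓝 0) := by
    exact hm.const_div_atTop 1
  have h2 : Tendsto (fun n : ℕ => (8 : ℝ) / (n - 1)) atTop (𝓝 0) :=
    (tendsto_atTop_add_const_right _ (-1) tendsto_natCast_atTop_atTop).const_div_atTop 8
  have h3 : Tendsto (fun n => (11 + c) * x n) atTop (𝓝 0) := by
    simpa using hx.const_mul (11 + c)
  have h4 : Tendsto (fun n => Real.exp ((11 + c) * x n) - Real.exp (-((11 + c) * x n)) ^ 2) atTop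
      (𝓝 0) := by
    have h5 := (Real.continuous_exp.tendsto 0).comp h3
    have h6 := ((Real.continuous_exp.tendsto _).comp h3.neg).pow 2
    simpa using h5.sub h6
  simpa [failBound] using
    ((h1.div_const (δ ^ 2)).add (((h1.add h2).add h4).div_const (δ ^ 2))).const_mul 2

theorem tendsto_measureReal_tau_lt {p : ℕ → I} {c₁ c₂ : ℝ} (hc₁ : 0 < c₁)
    (h₁ : ∀ᶠ n : ℕ in atTop, c₁ ≤ meanCodegree n (p n))
    (h₂ : ∀ᶠ n : ℕ in atTop, meanCodegree n (p n) ≤ c₂) {ε : ℝ} (hε : 0 < ε) :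
    Tendsto (fun n : ℕ => (SimpleGraph.binomialRandom (Fin n) (p n)).real
      {G : SimpleGraph (Fin n) | (tau G : ℝ) <
        (1 + ε) * psi (meanCodegree n (p n)) * meanEdges n (p n)}) atTop (𝓝 1) := by
  have hn1 : Tendsto (fun n : ℕ => (n : ℝ) - 2) atTop atTop :=
    tendsto_atTop_add_const_right _ (-2) tendsto_natCast_atTop_atTop
  have hp : Tendsto (fun n => (p n : ℝ)) atTop (𝓝 0) := by
    have hsq : Tendsto (fun n => (p n : ℝ) ^ 2) atTop (𝓝 0) := by
      refine tendsto_of_tendsto_of_tendsto_of_le_of_le' tendsto_const_nhds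
        (hn1.const_div_atTop c₂) (.of_forall fun n => sq_nonneg _) ?_
      filter_upwards [h₂, hn1.eventually_gt_atTop 0] with n hn hn0
      rw [le_div_iff₀ hn0, mul_comm]
      exact hn
    have := (Real.continuous_sqrt.tendsto 0).comp hsq
    rw [Real.sqrt_zero] at this
    exact this.congr fun n => Real.sqrt_sq (p n).2.1
  have hm : Tendsto (fun n => meanEdges n (p n)) atTop atTop := by
    -- A crude linear bound suffices: p² ≤ p gives (n-1)p ≥ d ≥ c₁, hence m ≥ c₁n/2.
    have : Tendsto (fun n : ℕ => c₁ / 2 * (n : ℝ)) atTop atTop :=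
      tendsto_natCast_atTop_atTop.const_mul_atTop (by positivity)
    refine tendsto_atTop_mono' _ ?_ this
    filter_upwards [h₁, hn1.eventually_gt_atTop 0] with n hn hn0
    have hp0 : (0 : ℝ) ≤ p n := (p n).2.1
    have hp1 : (p n : ℝ) ≤ 1 := (p n).2.2
    rw [meanCodegree] at hn
    rw [meanEdges, Nat.cast_choose_two]
    have h3 : c₁ ≤ ((n : ℝ) - 1) * p n := by
      have h4 : (p n : ℝ) ^ 2 ≤ p n := by nlinarith
      have := mul_le_mul_of_nonneg_left h4 hn0.le
      linarith
    have : (n : ℝ) * c₁ ≤ n * (((n : ℝ) - 1) * p n) := by gcongr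
    linarith
  set ψ₀ := (1 / 2) * (1 - Real.exp (-(c₁ / 2))) with hψ₀
  have hψpos : 0 < ψ₀ := by
    have : Real.exp (-(c₁ / 2)) < 1 := by
      rw [← Real.exp_zero, Real.exp_lt_exp]
      linarith
    rw [hψ₀]
    linarith
  set δ := ε * ψ₀ / 6 with hδ
  have hδ0 : 0 < δ := by positivity
  have herr : Tendsto (fun n : ℕ => (errorConst c₂ * (p n : ℝ) +
      (1 + errorConst c₂ * (p n : ℝ)) / n) / 2) atTop (𝓝 0) := by
    have h3 : Tendsto (fun n => errorConst c₂ * (p n : ℝ)) atTop (𝓝 0) := by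
      simpa using hp.const_mul (errorConst c₂)
    simpa using (h3.add ((h3.const_add 1).div_atTop tendsto_natCast_atTop_atTop)).div_const 2
  have hlow : Tendsto (fun n => 1 - failBound n (p n) c₂ δ) atTop (𝓝 1) := by
    simpa using (tendsto_failBound c₂ δ hp hm).const_sub 1
  refine tendsto_of_tendsto_of_tendsto_of_le_of_le' hlow tendsto_const_nhds ?_
    (.of_forall fun n => measureReal_le_one)
  filter_upwards [h₁, h₂, hm.eventually_gt_atTop 0, eventually_ge_atTop 3,
    hp.eventually_le_const (by norm_num : (0 : ℝ) < 1 / 2), herr.eventually_le_const hδ0]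
    with n hd1 hd2 hmn hn hpn hen
  have hfail := measureReal_lt_tau_le (p n) hn hpn hd2 hδ0 hmn
  have hcompl := probReal_compl_eq_one_sub (μ := SimpleGraph.binomialRandom (Fin n) (p n))
    (s := {G | (psi (meanCodegree n (p n)) + 4 * δ + (errorConst c₂ * p n +
      (1 + errorConst c₂ * p n) / n) / 2) * meanEdges n (p n) < tau G}) .of_discrete
  refine le_trans (by linarith) (hcompl.symm.le.trans (measureReal_mono ?_ (measure_ne_top _ _)))
  intro G hG
  simp only [Set.mem_compl_iff, Set.mem_ofPred_eq, not_lt] at hG ⊢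
  refine hG.trans_lt (mul_lt_mul_of_pos_right ?_ hmn)
  have := mul_le_mul_of_nonneg_left (le_psi hc₁.le hd1) hε.le
  rw [← hψ₀] at this
  linarith

end TriangleCover

theorem mainTheorem4 (p : ℕ → I)
    (hd : (fun n : ℕ => TriangleCover.meanCodegree n (p n)) =Θ[atTop] (fun _ => (1 : ℝ))) :
    ∃ ε : ℕ → ℝ, Tendsto ε atTop (𝓝 0) ∧
      Tendsto
        (fun n : ℕ => (SimpleGraph.binomialRandom (Fin n) (p n)).real
          {G : SimpleGraph (Fin n) |
            (TriangleCover.tau G : ℝ) <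
              (1 + ε n) * TriangleCover.psi (TriangleCover.meanCodegree n (p n)) *
                TriangleCover.meanEdges n (p n)})
        atTop (𝓝 1) := by
  obtain ⟨c₂, -, hc₂⟩ := hd.1.exists_pos
  obtain ⟨k, hk, hk'⟩ := hd.2.exists_pos
  have hnonneg : ∀ᶠ n : ℕ in atTop, 0 ≤ TriangleCover.meanCodegree n (p n) := by
    filter_upwards [eventually_ge_atTop 2] with n hn
    have : (2 : ℝ) ≤ n := by exact_mod_cast hn
    exact mul_nonneg (by linarith) (sq_nonneg _)
  have h₂ : ∀ᶠ n : ℕ in atTop, TriangleCover.meanCodegree n (p n) ≤ c₂ := by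
    filter_upwards [hc₂.bound] with n hn
    rw [norm_one, mul_one] at hn
    exact (le_abs_self _).trans hn
  have h₁ : ∀ᶠ n : ℕ in atTop, 1 / k ≤ TriangleCover.meanCodegree n (p n) := by
    filter_upwards [hk'.bound, hnonneg] with n hn hn0
    rw [norm_one, Real.norm_of_nonneg hn0] at hn
    rwa [div_le_iff₀' hk]
  refine TriangleCover.exists_tendsto_zero_tendsto_one
    (f := fun n ε => (SimpleGraph.binomialRandom (Fin n) (p n)).real
      {G : SimpleGraph (Fin n) | (TriangleCover.tau G : ℝ) <
        (1 + ε) * TriangleCover.psi (TriangleCover.meanCodegree n (p n)) *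
          TriangleCover.meanEdges n (p n)}) ?_
    (fun n ε => MeasureTheory.measureReal_nonneg) (fun n ε => MeasureTheory.measureReal_le_one)
    (fun ε hε => TriangleCover.tendsto_measureReal_tau_lt (by positivity) h₁ h₂ hε)
  -- Monotonicity in ε needs ψ(d) ≥ 0, which is derived from d ≥ 0; that is ensured only for n ≥ 2.
  filter_upwards [hnonneg] with n hn ε ε' hεε'
  refine MeasureTheory.measureReal_mono (fun G hG => ?_) (MeasureTheory.measure_ne_top _ _)
  have hψ : 0 ≤ TriangleCover.psi (TriangleCover.meanCodegree n (p n)) := by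
    simpa using TriangleCover.le_psi le_rfl hn
  have hm : 0 ≤ TriangleCover.meanEdges n (p n) := mul_nonneg (Nat.cast_nonneg _) (p n).2.1
  refine lt_of_lt_of_le (Set.mem_ofPred_eq ▸ hG) ?_
  gcongr
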